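/- Let $\Gamma$ be a countable discrete group with a sofic approximation $\Sigma=(\sigma_i\colon\Gamma\to S_{d_i})_{i\ge 1}$; that is, the $\sigma_i$ are maps (not necessarily homomorphisms) such that, with $u_d$ the uniform probability measure on $\{1,\dots,d\}$, $u_{d_i}(\{k:\sigma_i(g)\sigma_i(h)(k)=\sigma_i(gh)(k)\})\to 1$ for all $g,h\in\Gamma$ and $u_{d_i}(\{k:\sigma_i(g)(k)\neq\sigma_i(h)(k)\})\to 1$ for all $g\neq h$ in $\Gamma$. Let $\Gamma$ act by measure-preserving transformations on a standard probability space $(X,\mathcal M,\mu)$, let $\rho$ be the unitary representation $(\rho(g)\xi)(x)=\xi(g^{-1}x)$ of $\Gamma$ on $L^2(X,\mu)$, let $\rho^0$ be its restriction to $L^2(X,\mu)\ominus\mathbb C1$, and let $\lambda_\Gamma$ be the left regular representation on $\ell^2(\Gamma)$, $(\lambda_\Gamma(g)f)(x)=f(g^{-1}x)$. Unitary representations $\rho_1,\rho_2$ are called singular, $\rho_1\perp\rho_2$, if no nonzero subrepresentation of $\rho_1$ (restriction to a closed invariant linear subspace) embeds isometrically and equivariantly into $\rho_2$. The sofic entropy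 $h_{\Sigma,\mu}(X,\Gamma)\in[-\infty,\infty]$ is defined as follows. A finite observable is a measurable map from $X$ to a finite set. For a finite observable $\beta\colon X\to B$, a finite $F\subseteq\Gamma$ with $e\in F$, $\delta>0$ and $\sigma\colon\Gamma\to S_d$, let $\mathrm{AP}(\beta,F,\delta,\sigma)$ be the set of all $\phi\colon\{1,\dots,d\}\to B^F$ with $\sum_{a\in B^F}\left|u_d(\phi^{-1}(\{a\}))-\mu(\{x:\beta(g^{-1}x)=a(g)\ \forall g\in F\})\right|<\delta$ and $u_d(\{j:\phi(j)(g)\neq\phi(\sigma(g)^{-1}(j))(e)\})<\delta$ for all $g\in F$. Then \[h_{\Sigma,\mu}(X,\Gamma)=\sup_{\alpha}\ \inf_{\beta,\pi}\ \inf_{F,\delta}\ \limsup_{i\to\infty}\frac1{d_i}\log\left|\left\{j\mapsto\pi(\phi(j)(e))\,:\,\phi\in \mathrm{AP}(\beta,F,\delta,\sigma_i)\right\}\right|,\] where $\log 0=-\infty$, $\alpha\colon X\to A$ and $\beta\colon X\to B$ run over the finite observables, and $\pi\colon B\to A$ over the maps with $\pi\circ\beta=\alpha$ almost everywhere. Let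 $\mathcal H\subseteq L^2(X,\mu)$ be a closed $\Gamma$-invariant linear subspace such that $\mathcal M$ is generated, up to sets of measure zero, by $\{g f^{-1}(A): g\in\Gamma,\ f\in\mathcal H,\ A\subseteq\mathbb C\text{ Borel}\}$. (1) If $\rho|_{\mathcal H}\perp\lambda_\Gamma$, then $h_{\Sigma,\mu}(X,\Gamma)\le 0$. (2) If $\Gamma$ is infinite and the restriction of $\rho^0$ to $\mathcal H\cap(L^2(X,\mu)\ominus\mathbb C1)$ is singular with respect to $\lambda_\Gamma$, then $h_{\Sigma,\mu}(X,\Gamma)\le 0$. -/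

import Mathlib

open MeasureTheory Filter Topology
open scoped ENNReal

/-! ### Sofic approximations -/

/-- The uniform probability `u_d` of the set of points of `{1,…,d}` satisfying `P`. -/
noncomputable def unifProb (d : ℕ) (P : Fin d → Prop) : ℝ :=
  (Set.ncard {k | P k} : ℝ) / d

/-- A sofic approximation of `Γ`: a sequence of maps `σ i : Γ → Sym(d i)` that are asymptotically
multiplicative and asymptotically free. -/
structure SoficApproximation (Γ : Type*) [Group Γ] where
  d : ℕ → ℕ
  d_pos : ∀ i, 0 < d i
  σ : ∀ i, Γ → Equiv.Perm (Fin (d i))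
  tendsto_mul : ∀ g h : Γ,
    Tendsto (fun i => unifProb (d i) fun k => σ i g (σ i h k) = σ i (g * h) k) atTop (𝓝 1)
  tendsto_ne : ∀ g h : Γ, g ≠ h →
    Tendsto (fun i => unifProb (d i) fun k => σ i g k ≠ σ i h k) atTop (𝓝 1)

/-! ### Sofic measure entropy through finite observables -/

section Entropy

variable {Γ : Type*} [Group Γ] {X : Type*} [MeasurableSpace X] [MulAction Γ X]

open scoped Classical in
/-- The approximate microstates `AP(β, F, δ, σ)` of a finite observable `β : X → B`, where `F` is a
finite subset of `Γ` containing the identity: the maps `φ : {1,…,d} → B^F` whose distribution is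
`δ`-close to that of `x ↦ (β (g⁻¹ x))_{g ∈ F}` and which satisfy
`φ(j)(g) = φ(σ(g)⁻¹ j)(e)` for all `j` outside a set of uniform probability less than `δ`. -/
noncomputable def AP (μ : Measure X) {B : Type*} [Fintype B] (β : X → B) (F : Finset Γ) (hF : 1 ∈ F) (δ : ℝ)
    {d : ℕ} (σ : Γ → Equiv.Perm (Fin d)) : Set (Fin d → (F → B)) :=
  {φ | (∑ a : F → B,
          |unifProb d (fun j => φ j = a) - μ.real {x | ∀ g : F, β ((g : Γ)⁻¹ • x) = a g}|) < δ ∧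
        ∀ g : F, unifProb d (fun j => φ j g ≠ φ ((σ g)⁻¹ j) ⟨1, hF⟩) < δ}

/-- `h(α; β, F, δ) = limsup (1 / d_i) log |π*(AP(β, F, δ, σ_i))|`, where `π : B → A` satisfies
`π ∘ β = α` almost everywhere. Here `log 0 = -∞`. -/
noncomputable def obsEntropyAux (Sg : SoficApproximation Γ) (μ : Measure X)
    {A B : Type*} [Fintype B] (β : X → B) (π : B → A) (F : Finset Γ) (hF : 1 ∈ F) (δ : ℝ) : EReal :=
  limsup (fun i =>
    ENNReal.log (((fun φ : Fin (Sg.d i) → (F → B) => fun j => π (φ j ⟨1, hF⟩)) ''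
      AP μ β F hF δ (Sg.σ i)).ncard : ℝ≥0∞) / ((Sg.d i : ℝ) : EReal)) atTop

/-- `h(α; β)`: the infimum of `h(α; β, F, δ)` over finite `F ∋ 1` and `δ > 0`. -/
noncomputable def obsEntropyRel (Sg : SoficApproximation Γ) (μ : Measure X)
    {A B : Type*} [Fintype B] (β : X → B) (π : B → A) : EReal :=
  ⨅ (F : Finset Γ) (hF : 1 ∈ F) (δ : ℝ) (_ : 0 < δ), obsEntropyAux Sg μ β π F hF δ

/-- `h(α)`: the infimum of `h(α; β)` over all finite observables `β` refining `α`. -/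
noncomputable def obsEntropy (Sg : SoficApproximation Γ) (μ : Measure X)
    {A : Type*} (α : X → A) : EReal :=
  ⨅ (m : ℕ) (β : X → Fin m) (_ : Measurable β) (π : Fin m → A) (_ : ∀ᵐ x ∂μ, π (β x) = α x),
    obsEntropyRel Sg μ β π

/-- The sofic measure entropy `h_{Σ,μ}(X, Γ)`, an element of `[-∞, ∞]`: the supremum of `h(α)` over
all finite observables `α`. -/
noncomputable def soficEntropy (Sg : SoficApproximation Γ) (μ : Measure X) : EReal :=
  ⨆ (n : ℕ) (α : X → Fin n) (_ : Measurable α), obsEntropy Sg μ α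

end Entropy

/-! ### Unitary representations -/

/-- A unitary representation of the discrete group `Γ` on `E`. -/
abbrev UnitaryRep (Γ : Type*) [Group Γ] (E : Type*) [NormedAddCommGroup E]
    [InnerProductSpace ℂ E] := Γ →* (E ≃ₗᵢ[ℂ] E)

namespace UnitaryRep

variable {Γ : Type*} [Group Γ]
  {E : Type*} [NormedAddCommGroup E] [InnerProductSpace ℂ E]
  {E' : Type*} [NormedAddCommGroup E'] [InnerProductSpace ℂ E']

/-- The unitary representation given by a multiplicative family of linear isometries. -/
noncomputable def ofIsometries (T : Γ → E →ₗᵢ[ℂ] E) (h1 : ∀ v, T 1 v = v)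
    (hmul : ∀ g h v, T (g * h) v = T g (T h v)) : UnitaryRep Γ E where
  toFun g :=
    { toLinearEquiv := LinearEquiv.ofLinearMap (T g).toLinearMap (T g⁻¹).toLinearMap
        (by ext v; simp [← hmul, h1]) (by ext v; simp [← hmul, h1])
      norm_map' := fun v => (T g).norm_map v }
  map_one' := by ext v; exact h1 v
  map_mul' g h := by ext v; exact hmul g h v

/-- A subrepresentation: a closed invariant linear subspace. -/
def IsSubrep (ρ : UnitaryRep Γ E) (K : Submodule ℂ E) : Prop :=
  IsClosed (K : Set E) ∧ ∀ g : Γ, ∀ v ∈ K, ρ g v ∈ K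

theorem IsSubrep.inf {ρ : UnitaryRep Γ E} {K L : Submodule ℂ E} (hK : ρ.IsSubrep K)
    (hL : ρ.IsSubrep L) : ρ.IsSubrep (K ⊓ L) :=
  ⟨hK.1.inter hL.1, fun g v hv => ⟨hK.2 g v hv.1, hL.2 g v hv.2⟩⟩

/-- The restriction of `ρ` to a subrepresentation `K`. -/
noncomputable def restrict (ρ : UnitaryRep Γ E) (K : Submodule ℂ E) (hK : ρ.IsSubrep K) :
    UnitaryRep Γ K :=
  ofIsometries
    (fun g =>
      { toLinearMap := (ρ g).toLinearEquiv.toLinearMap.restrict (hK.2 g)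
        norm_map' := fun v => (ρ g).norm_map v })
    (fun v => by ext; change ρ 1 (v : E) = v; simp)
    (fun g h v => by ext; change ρ (g * h) (v : E) = ρ g (ρ h v); simp)

/-- `ρ` is singular with respect to `ρ'`: no nonzero subrepresentation of `ρ` embeds
(isometrically and equivariantly) into `ρ'`. -/
def Singular (ρ : UnitaryRep Γ E) (ρ' : UnitaryRep Γ E') : Prop :=
  ∀ (K : Submodule ℂ E) (hK : ρ.IsSubrep K) (T : K →ₗᵢ[ℂ] E'),
    (∀ (g : Γ) (v : K), T (ρ.restrict K hK g v) = ρ' g (T v)) → K = ⊥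

end UnitaryRep

/-- Left translation `(λ(g) f)(x) = f(g⁻¹ x)` on `ℓ²(Γ)`. -/
noncomputable def leftTranslate {Γ : Type*} [Group Γ] (g : Γ) :
    lp (fun _ : Γ => ℂ) 2 →ₗᵢ[ℂ] lp (fun _ : Γ => ℂ) 2 where
  toFun f := ⟨fun x => f (g⁻¹ * x), by
    have h := lp.memℓp f
    rw [memℓp_gen_iff (by norm_num)] at h
    exact (memℓp_gen_iff (by norm_num)).mpr ((Equiv.mulLeft g⁻¹).summable_iff.mpr h)⟩
  map_add' _ _ := rfl
  map_smul' _ _ := rfl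
  norm_map' f := by
    rw [lp.norm_eq_tsum_rpow (by norm_num), lp.norm_eq_tsum_rpow (by norm_num)]
    congr 1
    exact (Equiv.mulLeft g⁻¹).tsum_eq (fun x => ‖f x‖ ^ (2 : ℝ≥0∞).toReal)

/-- The left regular representation of `Γ` on `ℓ²(Γ)`. -/
noncomputable def leftRegular (Γ : Type*) [Group Γ] : UnitaryRep Γ (lp (fun _ : Γ => ℂ) 2) :=
  UnitaryRep.ofIsometries leftTranslate
    (fun f => by ext x; change f (1⁻¹ * x) = f x; simp)
    (fun g h f => by
      ext x; change f ((g * h)⁻¹ * x) = f (h⁻¹ * (g⁻¹ * x)); simp [mul_assoc])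

section Koopman

variable (Γ : Type*) [Group Γ] {X : Type*} [MeasurableSpace X] [MulAction Γ X]
  [MeasurableConstSMul Γ X] (μ : Measure X) [SMulInvariantMeasure Γ X μ]

/-- The representation `(ρ(g) ξ)(x) = ξ(g⁻¹ x)` of `Γ` on `L²(X, μ)`. -/
noncomputable def koopman : UnitaryRep Γ (Lp ℂ 2 μ) :=
  UnitaryRep.ofIsometries
    (fun g => Lp.compMeasurePreservingₗᵢ ℂ (fun x => g⁻¹ • x) (measurePreserving_smul g⁻¹ μ))
    (fun f => by
      refine Lp.ext ((Lp.coeFn_compMeasurePreserving f _).trans ?_)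
      exact Eventually.of_forall fun x => by simp)
    (fun g h f => by
      refine Lp.ext ((Lp.coeFn_compMeasurePreserving f _).trans ?_)
      refine EventuallyEq.symm ((Lp.coeFn_compMeasurePreserving _ _).trans ?_)
      refine ((measurePreserving_smul g⁻¹ μ).quasiMeasurePreserving.ae_eq_comp
        (Lp.coeFn_compMeasurePreserving f (measurePreserving_smul h⁻¹ μ))).trans ?_
      exact Eventually.of_forall fun x => by simp [mul_smul])

/-- `L²(X, μ) ⊖ ℂ1`. -/
noncomputable def meanZero [IsProbabilityMeasure μ] : Submodule ℂ (Lp ℂ 2 μ) :=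
  (Submodule.span ℂ {Lp.const 2 μ (1 : ℂ)})ᗮ

theorem isSubrep_meanZero [IsProbabilityMeasure μ] : (koopman Γ μ).IsSubrep (meanZero μ) := by
  refine ⟨Submodule.isClosed_orthogonal _, fun g v hv => ?_⟩
  have h1 : koopman Γ μ g (Lp.const 2 μ (1 : ℂ)) = Lp.const 2 μ (1 : ℂ) := by
    refine Lp.ext ((Lp.coeFn_compMeasurePreserving _ (measurePreserving_smul g⁻¹ μ)).trans ?_)
    refine ((measurePreserving_smul g⁻¹ μ).quasiMeasurePreserving.ae_eq_comp
      (Lp.coeFn_const (p := 2) (μ := μ) (1 : ℂ))).trans ?_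
    exact (Lp.coeFn_const (p := 2) (μ := μ) (1 : ℂ)).symm
  rw [meanZero, Submodule.mem_orthogonal_singleton_iff_inner_right] at hv ⊢
  rw [← h1, LinearIsometryEquiv.inner_map_map, hv]

variable {μ} in
/-- The `σ`-algebra of `X` is generated, up to sets of measure zero, by the sets `g f⁻¹(A)` for
`g ∈ Γ`, `f ∈ H` and `A ⊆ ℂ` Borel. -/
def Generates (H : Submodule ℂ (Lp ℂ 2 μ)) : Prop :=
  ∀ E : Set X, MeasurableSet E → ∃ E' : Set X,
    MeasurableSet[MeasurableSpace.generateFrom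
      {S : Set X | ∃ (g : Γ) (f : Lp ℂ 2 μ) (A : Set ℂ), f ∈ H ∧ MeasurableSet A ∧
        S = (fun x => g • x) '' ((f : X → ℂ) ⁻¹' A)}] E' ∧ E =ᵐ[μ] E'

end Koopman

/-! Singularity is turned into a dimension estimate on the finite models. By polar decomposition, a
representation singular to the regular one admits no nonzero bounded intertwiner into `ℓ²(Γ)`
(`Singular.intertwiner_eq_zero`). Apply this to the projection onto the closed span of the
translates of `(δ_e, ξ)` in `ℓ²(Γ) ⊕ G`: it forces `(0, ξ)` into that span. So there is a finitely
supported `c` with `‖c‖₂` tiny and `c · ξ` close to `ξ`, and one `c` serves finitely many vectors at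
once (`exists_finsupp_small_of_singular`).

On a sofic model, `c` acts on `ℂ^d` by `shiftOp`. Asymptotic freeness makes its squared
Hilbert-Schmidt norm at most about `d ‖c‖₂²`, so up to a small operator-norm error it has rank at
most a small multiple of `d` (`LinearMap.exists_submodule_norm_sub_le`). A microstate turns each of
the finitely many functions into a vector of length `O(√d)` almost fixed by this operator, hence
close to a subspace of small relative dimension. By a volume bound such vectors have few separated
positions.

Since `H` generates, finitely many functions in `H` determine the observable off a small set
(`Generates.exists_finset_separating`). After discretization their vectors therefore determine the
coloring up to small Hamming distance. Multiplying the volume bound by the size of a Hamming ball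
gives at most `exp (ε d)` colorings for large `i`. For infinite `Γ` the constants are harmless,
because `ℓ²(Γ)` has no nonzero invariant vector (`UnitaryRep.singular_of_singular_inf`). -/

/-! ### Intertwiners and singular representations -/

namespace UnitaryRep

variable {Γ : Type*} [Group Γ]
  {E : Type*} [NormedAddCommGroup E] [InnerProductSpace ℂ E]
  {E' : Type*} [NormedAddCommGroup E'] [InnerProductSpace ℂ E']

/-- Polar decomposition: a bounded intertwiner out of a representation singular with respect to
the target vanishes. -/
theorem Singular.intertwiner_eq_zero [CompleteSpace E] [CompleteSpace E'] {ρ : UnitaryRep Γ E}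
    {ρ' : UnitaryRep Γ E'} (h : ρ.Singular ρ') (T : E →L[ℂ] E')
    (hT : ∀ g v, T (ρ g v) = ρ' g (T v)) : T = 0 := by
  set P : E →L[ℂ] E := (ContinuousLinearMap.adjoint T) ∘L T with hP
  have hP0 : 0 ≤ P := by
    rw [ContinuousLinearMap.nonneg_iff_isPositive]
    exact ContinuousLinearMap.isPositive_adjoint_comp_self T
  -- `S` is the absolute value `|T|`. The norm identity `‖S x‖ = ‖T x‖` makes `S x ↦ T x` a
  -- well-defined isometry on the range of `S`.
  set S : E →L[ℂ] E := CFC.sqrt P with hS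
  have hSS : S * S = P := CFC.sqrt_mul_sqrt_self P hP0
  have hSsa : ContinuousLinearMap.adjoint S = S := by
    have : 0 ≤ S := CFC.sqrt_nonneg P
    exact (IsSelfAdjoint.of_nonneg this).star_eq
  have hnorm : ∀ x, ‖S x‖ = ‖T x‖ := by
    intro x
    have h1 : inner ℂ (S x) (S x) = inner ℂ (T x) (T x) := by
      calc inner ℂ (S x) (S x) = inner ℂ (ContinuousLinearMap.adjoint S x) (S x) := by rw [hSsa]
        _ = inner ℂ x ((S * S) x) := by
            rw [ContinuousLinearMap.adjoint_inner_left]; rfl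
        _ = inner ℂ (T x) (T x) := by
            rw [hSS, hP, ContinuousLinearMap.comp_apply, ContinuousLinearMap.adjoint_inner_right]
    rw [inner_self_eq_norm_sq_to_K, inner_self_eq_norm_sq_to_K] at h1
    have h2 : ‖S x‖ ^ 2 = ‖T x‖ ^ 2 := by exact_mod_cast h1
    exact (pow_left_inj₀ (norm_nonneg _) (norm_nonneg _) two_ne_zero).1 h2
  have hcomm : ∀ g x, S (ρ g x) = ρ g (S x) := by
    intro g
    let U : E →L[ℂ] E := ((ρ g).toContinuousLinearEquiv : E →L[ℂ] E)
    have hU : ∀ x, U x = ρ g x := fun _ => rfl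
    have hPU : Commute P U := by
      ext x
      refine ext_inner_left ℂ fun y => ?_
      have hy : ρ g (ρ g⁻¹ y) = y := by
        simp
      change inner ℂ y (P (U x)) = inner ℂ y (U (P x))
      rw [hU, hU, hP, ContinuousLinearMap.comp_apply, ContinuousLinearMap.comp_apply,
        ContinuousLinearMap.adjoint_inner_right, hT]
      conv_lhs => rw [← hy]
      conv_rhs => rw [← hy]
      rw [hT, LinearIsometryEquiv.inner_map_map, LinearIsometryEquiv.inner_map_map,
        ContinuousLinearMap.adjoint_inner_right]
    -- `U` commutes with `P`, hence with every function of `P`.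
    have hSU : Commute S U := by
      rw [hS, CFC.sqrt_eq_cfc]
      exact hPU.cfc_nnreal _
    intro x
    exact DFunLike.congr_fun hSU.eq x
  let K : Submodule ℂ E := S.range.topologicalClosure
  have hK : ρ.IsSubrep K := by
    refine ⟨Submodule.isClosed_topologicalClosure _, fun g v hv => ?_⟩
    have hm : Set.MapsTo (ρ g) (S.range : Set E) (S.range : Set E) := by
      rintro _ ⟨x, rfl⟩
      exact ⟨ρ g x, hcomm g x⟩
    exact hm.closure (ρ g).continuous hv
  have hmem : ∀ x, S x ∈ K := fun x => Submodule.le_topologicalClosure _ ⟨x, rfl⟩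
  let e : E →ₗ[ℂ] K := S.toLinearMap.codRestrict K hmem
  have hdense : DenseRange e := by
    intro y
    rw [Metric.mem_closure_iff]
    intro ε hε
    have hy : (y : E) ∈ closure (S.range : Set E) := y.2
    obtain ⟨_, ⟨x, rfl⟩, hx⟩ := Metric.mem_closure_iff.1 hy ε hε
    exact ⟨e x, ⟨x, rfl⟩, hx⟩
  have hle : ∀ x, ‖T.toLinearMap x‖ ≤ 1 * ‖e x‖ := fun x => by
    rw [one_mul]; exact (hnorm x).ge
  let V : K →L[ℂ] E' := T.toLinearMap.extendOfNorm e
  have hV : ∀ x, V (e x) = T x := fun x => LinearMap.extendOfNorm_eq hdense ⟨1, hle⟩ x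
  have hVnorm : ∀ y, ‖V y‖ = ‖y‖ := by
    intro y
    refine hdense.induction_on (p := fun y => ‖V y‖ = ‖y‖) y
      (isClosed_eq (by fun_prop) (by fun_prop)) fun x => ?_
    rw [hV, ← hnorm]; rfl
  -- `V` embeds the closed range of `S` equivariantly, so singularity makes this range zero.
  have hbot := h K hK ⟨V.toLinearMap, hVnorm⟩ (by
    intro g v
    change V (ρ.restrict K hK g v) = ρ' g (V v)
    refine hdense.induction_on (p := fun v => V (ρ.restrict K hK g v) = ρ' g (V v)) v
      (isClosed_eq (V.continuous.comp (ρ.restrict K hK g).continuous)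
        ((ρ' g).continuous.comp V.continuous)) fun x => ?_
    have : ρ.restrict K hK g (e x) = e (ρ g x) := Subtype.ext (hcomm g x).symm
    rw [this, hV, hV, hT])
  ext x
  have : S x = 0 := by
    have := hmem x
    rwa [hbot, Submodule.mem_bot] at this
  rw [zero_apply, ← norm_eq_zero, ← hnorm, this, norm_zero]

end UnitaryRep

theorem leftRegular_single {Γ : Type*} [Group Γ] [DecidableEq Γ] (g h : Γ) (c : ℂ) :
    leftRegular Γ g (lp.single 2 h c) = lp.single 2 (g * h) c := by
  ext x
  change (lp.single 2 h c : lp (fun _ : Γ => ℂ) 2) (g⁻¹ * x) = _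
  rw [lp.single_apply, lp.single_apply]
  by_cases hx : x = g * h
  · subst hx; simp
  · have : g⁻¹ * x ≠ h := fun e => hx (by rw [← e]; simp)
    simp [hx, this]

/-- If there are no nonzero intertwiners into the regular representation, then every vector `ξ` is
almost fixed by elements of the group ring of small `ℓ²`-norm. -/
theorem exists_finsupp_small_of_intertwiner_eq_zero {Γ : Type*} [Group Γ]
    {G : Type*} [NormedAddCommGroup G] [InnerProductSpace ℂ G] [CompleteSpace G]
    (ρ : UnitaryRep Γ G)
    (hρ : ∀ T : G →L[ℂ] lp (fun _ : Γ => ℂ) 2,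
      (∀ g v, T (ρ g v) = leftRegular Γ g (T v)) → T = 0)
    (ξ : G) {ε : ℝ} (hε : 0 < ε) :
    ∃ c : Γ →₀ ℂ, ∑ g ∈ c.support, ‖c g‖ ^ 2 ≤ ε ^ 2 ∧
      ‖∑ g ∈ c.support, c g • ρ g ξ - ξ‖ ≤ ε := by
  classical
  let Y := WithLp 2 (lp (fun _ : Γ => ℂ) 2 × G)
  -- The span `V` of these translates consists of the pairs `(c, c · ξ)` with `c` finitely
  -- supported, so the claim is that `(0, ξ)` lies in its closure.
  let w : Γ → Y := fun g => WithLp.toLp 2 (lp.single 2 g (1 : ℂ), ρ g ξ)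
  let V : Submodule ℂ Y := Submodule.span ℂ (Set.range w)
  let Vc : Submodule ℂ Y := V.topologicalClosure
  have : CompleteSpace Vc := V.isClosed_topologicalClosure.completeSpace_coe
  let U : Γ → (Y ≃ₗᵢ[ℂ] Y) := fun g =>
    LinearIsometryEquiv.withLpProdCongr 2 (leftRegular Γ g) (ρ g)
  have hUw : ∀ g h, U g (w h) = w (g * h) := by
    intro g h
    change WithLp.toLp 2 (leftRegular Γ g (lp.single 2 h 1), ρ g (ρ h ξ)) = _
    rw [leftRegular_single]
    change _ = WithLp.toLp 2 (lp.single 2 (g * h) 1, ρ (g * h) ξ)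
    rw [map_mul]; rfl
  have hVmap : ∀ g, V.map (U g).toLinearEquiv.toLinearMap = V := by
    intro g
    rw [Submodule.map_span, ← Set.range_comp]
    congr 1
    ext y
    constructor
    · rintro ⟨h, rfl⟩; exact ⟨g * h, (hUw g h).symm⟩
    · rintro ⟨h, rfl⟩
      refine ⟨g⁻¹ * h, ?_⟩
      have := hUw g (g⁻¹ * h)
      rw [mul_inv_cancel_left] at this
      exact this
  have hVcmap : ∀ g, ∀ y ∈ Vc, U g y ∈ Vc := by
    intro g y hy
    have hm : Set.MapsTo (U g) (V : Set Y) (V : Set Y) := by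
      intro x hx
      have : U g x ∈ V.map (U g).toLinearEquiv.toLinearMap := ⟨x, hx, rfl⟩
      rwa [hVmap] at this
    exact hm.closure (U g).continuous hy
  have hUinv : ∀ g y, U g (U g⁻¹ y) = y := by
    intro g y
    change WithLp.toLp 2 (leftRegular Γ g (leftRegular Γ g⁻¹ y.fst), ρ g (ρ g⁻¹ y.snd)) = y
    have h1 := DFunLike.congr_fun (map_mul ρ g g⁻¹) y.snd
    have h2 := DFunLike.congr_fun (map_mul (leftRegular Γ) g g⁻¹) y.fst
    simp only [mul_inv_cancel, map_one] at h1 h2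
    change y.snd = ρ g (ρ g⁻¹ y.snd) at h1
    change y.fst = leftRegular Γ g (leftRegular Γ g⁻¹ y.fst) at h2
    rw [← h1, ← h2]; rfl
  have hproj : ∀ g y, Vc.starProjection (U g y) = U g (Vc.starProjection y) := by
    intro g y
    refine (Submodule.eq_starProjection_of_mem_of_inner_eq_zero
      (hVcmap g _ (Submodule.starProjection_apply_mem _ _)) fun z hz => ?_)
    rw [← map_sub, ← hUinv g z, LinearIsometryEquiv.inner_map_map]
    exact Submodule.starProjection_inner_eq_zero _ _ (hVcmap _ _ hz)
  let ι : G →L[ℂ] Y := (WithLp.prodContinuousLinearEquiv 2 ℂ _ _).symm.toContinuousLinearMap ∘L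
    ContinuousLinearMap.inr ℂ _ _
  have hι : ∀ x, ι x = WithLp.toLp 2 (0, x) := fun _ => rfl
  let T : G →L[ℂ] lp (fun _ : Γ => ℂ) 2 := WithLp.fstL 2 ℂ _ _ ∘L Vc.starProjection ∘L ι
  have hT : T = 0 := by
    refine hρ T fun g v => ?_
    have : ι (ρ g v) = U g (ι v) := by
      rw [hι, hι]
      change _ = WithLp.toLp 2 (leftRegular Γ g 0, ρ g v)
      rw [map_zero]
    change (Vc.starProjection (ι (ρ g v))).fst = leftRegular Γ g (Vc.starProjection (ι v)).fst
    rw [this, hproj]; rfl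
  have hw1 : w 1 ∈ Vc := Submodule.le_topologicalClosure _ (Submodule.subset_span ⟨1, rfl⟩)
  -- `T = 0` says that the residual `z` has first coordinate zero, so it has the same inner product
  -- with `w 1 = (δ_e, ξ)` as with `(0, ξ)`. Being orthogonal to `Vc`, it is orthogonal to both
  -- terms of its own definition.
  have hzero : ι ξ - Vc.starProjection (ι ξ) = 0 := by
    set z := ι ξ - Vc.starProjection (ι ξ) with hz
    have hz1 : z.fst = 0 := by
      have : (Vc.starProjection (ι ξ)).fst = 0 := DFunLike.congr_fun hT ξ
      rw [hz, WithLp.sub_fst, this, sub_zero]; rfl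
    have h1 : inner ℂ z (w 1) = 0 := Submodule.starProjection_inner_eq_zero _ _ hw1
    have h2 : inner ℂ z (Vc.starProjection (ι ξ)) = 0 :=
      Submodule.starProjection_inner_eq_zero _ _ (Submodule.starProjection_apply_mem _ _)
    have h3 : inner ℂ z (ι ξ) = 0 := by
      rw [WithLp.prod_inner_apply] at h1 ⊢
      have e1 : (w 1).snd = ξ := by change ρ 1 ξ = ξ; rw [map_one]; rfl
      have e2 : (ι ξ).snd = ξ := rfl
      change inner ℂ z.fst _ + inner ℂ z.snd (w 1).snd = 0 at h1
      change inner ℂ z.fst _ + inner ℂ z.snd (ι ξ).snd = 0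
      rw [hz1, inner_zero_left, e1] at h1
      rw [hz1, inner_zero_left, e2, h1]
    have : inner ℂ z z = 0 := by
      nth_rewrite 2 [hz]
      rw [inner_sub_right, h2, h3, sub_zero]
    exact inner_self_eq_zero.1 this
  have hmem : ι ξ ∈ closure (V : Set Y) := by
    have : ι ξ ∈ Vc := by
      rw [sub_eq_zero.1 hzero]; exact Submodule.starProjection_apply_mem _ _
    exact this
  obtain ⟨y, hyV, hy⟩ := Metric.mem_closure_iff.1 hmem ε hε
  obtain ⟨c, rfl⟩ := (Finsupp.mem_span_range_iff_exists_finsupp).1 hyV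
  refine ⟨c, ?_⟩
  set y := c.sum fun i a => a • w i with hy'
  have hfst : y.fst = ∑ g ∈ c.support, lp.single 2 g (c g) := by
    change WithLp.fstₗ 2 ℂ _ _ y = _
    rw [hy', Finsupp.sum, map_sum]
    refine Finset.sum_congr rfl fun g _ => ?_
    change c g • (lp.single 2 g (1 : ℂ) : lp (fun _ : Γ => ℂ) 2) = _
    rw [← lp.single_smul]; simp
  have hsnd : y.snd = ∑ g ∈ c.support, c g • ρ g ξ := by
    change WithLp.sndₗ 2 ℂ _ _ y = _
    rw [hy', Finsupp.sum, map_sum]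
    rfl
  have hn : ‖y - ι ξ‖ ^ 2 = ‖y.fst‖ ^ 2 + ‖y.snd - ξ‖ ^ 2 := by
    rw [WithLp.prod_norm_sq_eq_of_L2]
    change ‖y.fst - 0‖ ^ 2 + ‖y.snd - ξ‖ ^ 2 = _
    rw [sub_zero]
  have hlt : ‖y - ι ξ‖ ^ 2 ≤ ε ^ 2 := by
    rw [← dist_eq_norm, dist_comm]
    gcongr
  have hs : ‖y.fst‖ ^ 2 = ∑ g ∈ c.support, ‖c g‖ ^ 2 := by
    have := lp.norm_sum_single (p := 2) (by norm_num) (fun g => c g) c.support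
    rw [hfst]
    simpa using this
  rw [← hsnd, ← hs]
  constructor
  · nlinarith [sq_nonneg ‖y.snd - ξ‖]
  · exact abs_le_of_sq_le_sq' (by nlinarith [sq_nonneg ‖y.fst‖]) hε.le |>.2

namespace UnitaryRep

/-- The diagonal representation on a finite `ℓ²`-power. -/
noncomputable def diagonal {Γ : Type*} [Group Γ] {E : Type*} [NormedAddCommGroup E]
    [InnerProductSpace ℂ E] (ι : Type*) [Fintype ι] (ρ : UnitaryRep Γ E) :
    UnitaryRep Γ (PiLp 2 fun _ : ι => E) where
  toFun g := LinearIsometryEquiv.piLpCongrRight 2 fun _ => ρ g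
  map_one' := by ext; simp
  map_mul' _ _ := by ext; simp

end UnitaryRep

/-- Passing to the power `E^ι` yields one `c` for all the vectors `ξ k`. An intertwiner out of the
power is the sum of its restrictions to the factors, and each of these vanishes. -/
theorem exists_finsupp_small_of_singular {Γ : Type*} [Group Γ]
    {E : Type*} [NormedAddCommGroup E] [InnerProductSpace ℂ E] [CompleteSpace E]
    {ρ : UnitaryRep Γ E} (hρ : ρ.Singular (leftRegular Γ))
    {ι : Type*} [Fintype ι] (ξ : ι → E) {ε : ℝ} (hε : 0 < ε) :
    ∃ c : Γ →₀ ℂ, ∑ g ∈ c.support, ‖c g‖ ^ 2 ≤ ε ^ 2 ∧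
      ∀ k, ‖∑ g ∈ c.support, c g • ρ g (ξ k) - ξ k‖ ≤ ε := by
  classical
  have hzero : ∀ T : (PiLp 2 fun _ : ι => E) →L[ℂ] lp (fun _ : Γ => ℂ) 2,
      (∀ g v, T (ρ.diagonal ι g v) = leftRegular Γ g (T v)) → T = 0 := by
    intro T hT
    let j : ι → E →L[ℂ] PiLp 2 fun _ : ι => E := fun k =>
      (PiLp.continuousLinearEquiv 2 ℂ fun _ : ι => E).symm.toContinuousLinearMap ∘L
        ContinuousLinearMap.single ℂ (fun _ : ι => E) k
    have hj : ∀ k v, j k v = WithLp.toLp 2 (Pi.single k v) := fun _ _ => rfl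
    have h0 : ∀ k, T ∘L j k = 0 := fun k => hρ.intertwiner_eq_zero _ fun g v => by
      change T (j k (ρ g v)) = leftRegular Γ g (T (j k v))
      rw [← hT]
      congr 1
      ext l
      rw [hj, hj]
      change (Pi.single k (ρ g v) : ι → E) l = ρ g ((Pi.single k v : ι → E) l)
      by_cases hl : l = k
      · subst hl; simp
      · simp [hl]
    ext1 x
    have hx : x = ∑ k, j k (x k) := by
      ext l
      simp [hj, WithLp.ofLp_sum, Finset.sum_apply, Pi.single_apply]
    rw [hx, map_sum]
    simpa using Finset.sum_eq_zero fun k _ => DFunLike.congr_fun (h0 k) (x k)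
  obtain ⟨c, hc, hc'⟩ := exists_finsupp_small_of_intertwiner_eq_zero
    (ρ.diagonal ι) hzero (WithLp.toLp 2 ξ) hε
  refine ⟨c, hc, fun k => le_trans ?_ hc'⟩
  refine le_trans (le_of_eq ?_) (PiLp.norm_apply_le _ k)
  congr 1
  simp only [PiLp.sub_apply, WithLp.ofLp_sum, Finset.sum_apply]
  rfl

/-! ### Low-rank approximation -/

/-- The right-hand side does not involve `b`, so the Hilbert-Schmidt sum may be moved from the
standard basis to an eigenbasis. -/
theorem LinearMap.sum_norm_sq_eq_trace {E ι : Type*} [NormedAddCommGroup E]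
    [InnerProductSpace ℂ E] [FiniteDimensional ℂ E] [Fintype ι] (A : E →ₗ[ℂ] E)
    (b : OrthonormalBasis ι ℂ E) :
    ((∑ l, ‖A (b l)‖ ^ 2 : ℝ) : ℂ) = LinearMap.trace ℂ E (LinearMap.adjoint A ∘ₗ A) := by
  rw [LinearMap.trace_eq_sum_inner _ b]
  push_cast
  refine Finset.sum_congr rfl fun l _ => ?_
  rw [Function.comp_apply, LinearMap.adjoint_inner_right, inner_self_eq_norm_sq_to_K]; rfl

/-- A linear map `A` of Hilbert-Schmidt norm `s` maps each `v` to within `t * ‖v‖` of a fixed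
subspace of dimension at most `s ^ 2 / t ^ 2`. -/
theorem LinearMap.exists_submodule_norm_sub_le {E ι : Type*} [NormedAddCommGroup E]
    [InnerProductSpace ℂ E] [FiniteDimensional ℂ E] [Fintype ι] (e : OrthonormalBasis ι ℂ E)
    (A : E →ₗ[ℂ] E) {t : ℝ} (ht : 0 ≤ t) :
    ∃ W : Submodule ℂ E, (Module.finrank ℂ W : ℝ) * t ^ 2 ≤ ∑ l, ‖A (e l)‖ ^ 2 ∧
      ∀ v, ∃ w ∈ W, ‖A v - w‖ ≤ t * ‖v‖ := by
  classical
  set P := LinearMap.adjoint A ∘ₗ A with hP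
  have hsym : P.IsSymmetric := (LinearMap.isPositive_adjoint_comp_self A).isSymmetric
  -- Singular value decomposition: an eigenbasis of `A* A` is carried by `A` to pairwise orthogonal
  -- vectors.
  let u := hsym.eigenvectorBasis rfl
  have hinner : ∀ x y, inner ℂ x (P y) = inner ℂ (A x) (A y) := fun x y => by
    rw [hP, LinearMap.comp_apply, LinearMap.adjoint_inner_right]
  have hsum : ∑ l, ‖A (u l)‖ ^ 2 = ∑ l, ‖A (e l)‖ ^ 2 := by
    exact_mod_cast (A.sum_norm_sq_eq_trace u).trans (A.sum_norm_sq_eq_trace e).symm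
  have horth : ∀ k l, k ≠ l → inner ℂ (A (u k)) (A (u l)) = 0 := by
    intro k l hkl
    rw [← hinner, hsym.apply_eigenvectorBasis, inner_smul_right,
      u.orthonormal.2 hkl, mul_zero]
  -- `W` collects the directions with singular value above `t`. There are few of them by Chebyshev,
  -- and by orthogonality the others contribute at most `t * ‖v‖`.
  let S := Finset.univ.filter fun l => t < ‖A (u l)‖
  let W := Submodule.span ℂ ((S.image fun l => A (u l) : Finset E) : Set E)
  refine ⟨W, ?_, fun v => ⟨∑ l ∈ S, inner ℂ (u l) v • A (u l), ?_, ?_⟩⟩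
  · have h1 : Module.finrank ℂ W ≤ S.card :=
      (finrank_span_finset_le_card _).trans Finset.card_image_le
    have h2 : (S.card : ℝ) * t ^ 2 ≤ ∑ l ∈ S, ‖A (u l)‖ ^ 2 := by
      rw [← nsmul_eq_mul]
      refine Finset.card_nsmul_le_sum _ _ _ fun l hl => ?_
      have := (Finset.mem_filter.1 hl).2
      gcongr
    rw [← hsum]
    calc (Module.finrank ℂ W : ℝ) * t ^ 2 ≤ S.card * t ^ 2 := by gcongr
      _ ≤ _ := h2
      _ ≤ _ := Finset.sum_le_univ_sum_of_nonneg fun _ => by positivity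
  · refine Submodule.sum_mem _ fun l hl => Submodule.smul_mem _ _ (Submodule.subset_span ?_)
    exact Finset.mem_coe.2 (Finset.mem_image_of_mem _ hl)
  · have hAv : A v - ∑ l ∈ S, inner ℂ (u l) v • A (u l)
        = ∑ l ∈ Finset.univ.filter (fun l => ¬ t < ‖A (u l)‖), inner ℂ (u l) v • A (u l) := by
      conv_lhs => rw [← u.sum_repr' v]
      rw [map_sum, ← Finset.sum_filter_add_sum_filter_not Finset.univ (fun l => t < ‖A (u l)‖)]
      rw [u.sum_repr' v]
      simp only [map_smul]
      exact add_sub_cancel_left _ _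
    rw [hAv]
    refine abs_le_of_sq_le_sq (a := ‖_‖) ?_ (by positivity) |> (abs_norm _).symm.le.trans
    have hpyth : ∀ s : Finset (Fin (Module.finrank ℂ E)),
        ‖∑ l ∈ s, inner ℂ (u l) v • A (u l)‖ ^ 2
          = ∑ l ∈ s, ‖inner ℂ (u l) v‖ ^ 2 * ‖A (u l)‖ ^ 2 := by
      intro s
      induction s using Finset.induction_on with
      | empty => simp
      | insert a s ha ih =>
        rw [Finset.sum_insert ha, Finset.sum_insert ha, ← ih, ← mul_pow, ← norm_smul]
        have := norm_add_sq_eq_norm_sq_add_norm_sq_of_inner_eq_zero (𝕜 := ℂ)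
          (inner ℂ (u a) v • A (u a)) (∑ l ∈ s, inner ℂ (u l) v • A (u l)) (by
            rw [inner_sum]
            refine Finset.sum_eq_zero fun l hl => ?_
            rw [inner_smul_left, inner_smul_right, horth a l (fun h => ha (h ▸ hl))]
            simp)
        simpa [sq] using this
    rw [hpyth, mul_pow, ← u.sum_sq_norm_inner_right v, Finset.mul_sum]
    calc _ ≤ ∑ l ∈ Finset.univ.filter (fun l => ¬ t < ‖A (u l)‖), t ^ 2 * ‖inner ℂ (u l) v‖ ^ 2 := by
          refine Finset.sum_le_sum fun l hl => ?_
          have := not_lt.1 (Finset.mem_filter.1 hl).2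
          rw [mul_comm]
          gcongr
      _ ≤ _ := Finset.sum_le_univ_sum_of_nonneg fun _ => by positivity

/-! ### Counting -/

/-- A volume bound on the size of an `r`-separated family in a ball of radius `R`. -/
theorem card_le_pow_finrank_of_separated {E ι : Type*} [NormedAddCommGroup E] [NormedSpace ℝ E]
    [FiniteDimensional ℝ E] (s : Finset ι) (w : ι → E) {R r : ℝ} (hR : 0 ≤ R) (hr : 0 < r)
    (hs : ∀ c ∈ s, ‖w c‖ ≤ R) (h : ∀ c ∈ s, ∀ d ∈ s, c ≠ d → r ≤ ‖w c - w d‖) :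
    (s.card : ℝ) ≤ (1 + 2 * R / r) ^ Module.finrank ℝ E := by
  borelize E
  let μ : Measure E := Measure.addHaar
  have δpos : 0 < r / 2 := by positivity
  have ρpos : 0 < R + r / 2 := by positivity
  set A := ⋃ c ∈ s, Metric.ball (w c) (r / 2) with hA
  have D : Set.Pairwise (s : Set ι)
      (Function.onFun Disjoint fun c => Metric.ball (w c) (r / 2)) := by
    rintro c hc d hd hcd
    apply Metric.ball_disjoint_ball
    rw [dist_eq_norm, add_halves]
    exact h c hc d hd hcd
  have A_subset : A ⊆ Metric.ball (0 : E) (R + r / 2) := by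
    refine Set.iUnion₂_subset fun x hx => ?_
    apply Metric.ball_subset_ball'
    rw [dist_zero_right, add_comm]
    gcongr
    exact hs x hx
  have I : (s.card : ℝ≥0∞) * ENNReal.ofReal ((r / 2) ^ Module.finrank ℝ E) * μ (Metric.ball 0 1) ≤
      ENNReal.ofReal ((R + r / 2) ^ Module.finrank ℝ E) * μ (Metric.ball 0 1) :=
    calc _ = μ A := by
          rw [hA, measure_biUnion_finset D fun c _ => measurableSet_ball]
          simp only [μ.addHaar_ball_of_pos _ δpos, Finset.sum_const, nsmul_eq_mul, mul_assoc]
      _ ≤ μ (Metric.ball (0 : E) (R + r / 2)) := measure_mono A_subset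
      _ = _ := by simp only [μ.addHaar_ball_of_pos _ ρpos]
  have J := (ENNReal.mul_le_mul_iff_left
    (Metric.measure_ball_pos μ _ zero_lt_one).ne' measure_ball_lt_top.ne).1 I
  have K := ENNReal.toReal_le_of_le_ofReal (pow_nonneg ρpos.le _) J
  rw [ENNReal.toReal_mul, ENNReal.toReal_natCast, ENNReal.toReal_ofReal (by positivity),
    ← le_div_iff₀ (by positivity), ← div_pow] at K
  refine K.trans (le_of_eq ?_)
  congr 1
  field_simp
  ring

/-- A finite set is bounded by the size of a separated subset times the size of a ball. -/
theorem Finset.card_le_mul_of_separated {Y : Type*} [DecidableEq Y] (S : Finset Y)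
    (close : Y → Y → Prop) [DecidableRel close] (hrefl : ∀ y, close y y)
    (hsymm : ∀ y z, close y z → close z y) {M N : ℝ} (hN0 : 0 ≤ N)
    (hN : ∀ y ∈ S, ((S.filter fun z => close y z).card : ℝ) ≤ N)
    (hM : ∀ T ⊆ S, (∀ y ∈ T, ∀ z ∈ T, y ≠ z → ¬ close y z) → (T.card : ℝ) ≤ M) :
    (S.card : ℝ) ≤ M * N := by
  let 𝒯 := S.powerset.filter fun T => ∀ y ∈ T, ∀ z ∈ T, y ≠ z → ¬ close y z
  -- A separated subset of maximal size is a net: a point close to none of its members could be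
  -- added.
  obtain ⟨T, hT, hmax⟩ := Finset.exists_max_image 𝒯 Finset.card ⟨∅, by simp [𝒯]⟩
  simp only [𝒯, Finset.mem_filter, Finset.mem_powerset] at hT hmax
  have hcover : S ⊆ T.biUnion fun y => S.filter fun z => close y z := by
    intro z hz
    by_contra hcon
    simp only [Finset.mem_biUnion, Finset.mem_filter, not_exists, not_and] at hcon
    have hzT : z ∉ T := fun hzT => hcon z hzT hz (hrefl z)
    have := hmax (insert z T) ⟨Finset.insert_subset hz hT.1, by
      intro a ha b hb hab
      rw [Finset.mem_insert] at ha hb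
      rcases ha with rfl | ha <;> rcases hb with rfl | hb
      · exact absurd rfl hab
      · exact fun hc => hcon b hb hz (hsymm _ _ hc)
      · exact hcon a ha hz
      · exact hT.2 a ha b hb hab⟩
    rw [Finset.card_insert_of_notMem hzT] at this
    omega
  calc (S.card : ℝ) ≤ ∑ y ∈ T, ((S.filter fun z => close y z).card : ℝ) := by
        exact_mod_cast (Finset.card_le_card hcover).trans Finset.card_biUnion_le
    _ ≤ T.card * N := by
        rw [← nsmul_eq_mul]
        exact Finset.sum_le_card_nsmul _ _ _ fun y hy => hN y (hT.1 hy)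
    _ ≤ M * N := mul_le_mul_of_nonneg_right (hM T hT.1 hT.2) hN0

/-- A Chernoff bound: the weights `x ^ hammingDist y z` factor over coordinates, so their total is
at most `(1 + n x) ^ d`, while every point of the ball has weight at least `x ^ k`. -/
theorem card_hammingBall_mul_pow_le {d n : ℕ} (y : Fin d → Fin n) {x : ℝ} (hx : 0 ≤ x)
    (hx1 : x ≤ 1) (k : ℕ) :
    ((Finset.univ.filter fun z => hammingDist y z ≤ k).card : ℝ) * x ^ k ≤ (1 + n * x) ^ d := by
  have h1 : ∑ z : Fin d → Fin n, x ^ hammingDist y z ≤ (1 + n * x) ^ d := by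
    have : ∀ z : Fin d → Fin n, x ^ hammingDist y z = ∏ j, if y j ≠ z j then x else 1 := by
      intro z
      rw [hammingDist, Finset.prod_ite, Finset.prod_const, Finset.prod_const_one, mul_one]
    simp_rw [this]
    rw [← Fintype.prod_sum (fun j a => if y j ≠ a then x else 1)]
    calc _ ≤ ∏ _j : Fin d, (1 + n * x) := by
          refine Finset.prod_le_prod (fun _ _ => Finset.sum_nonneg fun _ _ => by
            split_ifs <;> simp [hx]) fun j _ => ?_
          calc _ ≤ ∑ a : Fin n, ((if y j = a then 1 else 0) + x) := by
                refine Finset.sum_le_sum fun a _ => ?_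
                by_cases h : y j = a <;> simp [h, hx]
            _ = _ := by simp [Finset.sum_add_distrib]
      _ = _ := by simp
  refine le_trans ?_ h1
  rw [← nsmul_eq_mul]
  refine (Finset.card_nsmul_le_sum _ _ _ fun z hz => ?_).trans
    (Finset.sum_le_univ_sum_of_nonneg fun _ => by positivity)
  exact pow_le_pow_of_le_one hx hx1 (Finset.mem_filter.1 hz).2

/-- Hamming balls of small relative radius have small exponential growth rate. -/
theorem exists_card_hammingBall_le_exp (n : ℕ) {ε : ℝ} (hε : 0 < ε) :
    ∃ γ : ℝ, 0 < γ ∧ ∀ (d : ℕ) (y : Fin d → Fin n),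
      ((Finset.univ.filter fun z => (hammingDist y z : ℝ) ≤ γ * d).card : ℝ)
        ≤ Real.exp (ε * d) := by
  -- The exponent is split in halves: `x` makes `1 + n x ≤ exp (ε / 2)`, and then `γ` makes `x ^ (γ
  -- d) ≥ exp (-ε d / 2)`.
  set x : ℝ := min 1 (ε / (2 * (n + 1))) with hxdef
  have hx0 : 0 < x := by positivity
  have hx1 : x ≤ 1 := min_le_left _ _
  have hnx : n * x ≤ ε / 2 := by
    calc (n : ℝ) * x ≤ (n + 1) * (ε / (2 * (n + 1))) := by
          gcongr
          · linarith
          · exact min_le_right _ _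
      _ = ε / 2 := by field_simp
  have hL : 0 ≤ -Real.log x := by linarith [Real.log_nonpos hx0.le hx1]
  set γ : ℝ := ε / (2 * (-Real.log x + 1)) with hγ
  have hγ0 : 0 < γ := by positivity
  have hγL : γ * -Real.log x ≤ ε / 2 := by
    calc γ * -Real.log x ≤ γ * (-Real.log x + 1) := by gcongr; linarith
      _ = ε / 2 := by rw [hγ]; field_simp
  refine ⟨γ, hγ0, fun d y => ?_⟩
  have heq : (Finset.univ.filter fun z => (hammingDist y z : ℝ) ≤ γ * d)
      = Finset.univ.filter fun z => hammingDist y z ≤ ⌊γ * d⌋₊ := by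
    ext z
    simp [Nat.le_floor_iff (show 0 ≤ γ * d by positivity)]
  have h := card_hammingBall_mul_pow_le y hx0.le hx1 ⌊γ * d⌋₊
  rw [← heq] at h
  have hk : (⌊γ * d⌋₊ : ℝ) ≤ γ * d := Nat.floor_le (by positivity)
  have hpow : Real.exp (-(ε / 2 * d)) ≤ x ^ ⌊γ * d⌋₊ := by
    rw [← Real.exp_log (pow_pos hx0 _), Real.log_pow]
    apply Real.exp_le_exp.2
    have := mul_le_mul_of_nonneg_right hk hL
    have := mul_le_mul_of_nonneg_right hγL (Nat.cast_nonneg (α := ℝ) d)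
    nlinarith
  have hexp : (1 + n * x) ^ d ≤ Real.exp (ε / 2 * d) := by
    rw [mul_comm (ε / 2), Real.exp_nat_mul]
    gcongr
    have := Real.add_one_le_exp (ε / 2)
    linarith
  have := (mul_le_mul_of_nonneg_left hpow (Nat.cast_nonneg _)).trans (h.trans hexp)
  rw [Real.exp_neg, ← div_eq_mul_inv, div_le_iff₀ (Real.exp_pos _), ← Real.exp_add] at this
  rwa [← add_mul, add_halves] at this

/-! ### Sets determined by finitely many functions -/

section Separation

variable {X : Type*} [MeasurableSpace X] {μ : Measure X}

/-- Up to a set of measure at most `η`, membership in each of the sets `E i`, `i ∈ t`, is determined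
by the approximate values of finitely many functions in `H`. -/
def SeparatedBy (H : Submodule ℂ (Lp ℂ 2 μ)) {ι : Type*} (t : Finset ι) (E : ι → Set X)
    (η : ℝ≥0∞) : Prop :=
  ∃ s : Finset (Lp ℂ 2 μ), (∀ f ∈ s, f ∈ H) ∧ ∃ r : ℝ, 0 < r ∧ ∃ bad : Set X, μ bad ≤ η ∧
    ∀ x ∉ bad, ∀ y ∉ bad, (∀ f ∈ s, ‖f x - f y‖ < r) → ∀ i ∈ t, (x ∈ E i ↔ y ∈ E i)

/-- Membership in `E` is approximately determined by finitely many functions in `H`. -/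
def ApproxDetermined (H : Submodule ℂ (Lp ℂ 2 μ)) (E : Set X) : Prop :=
  ∀ η : ℝ≥0∞, η ≠ 0 → SeparatedBy H {()} (fun _ => E) η

variable {H : Submodule ℂ (Lp ℂ 2 μ)}

theorem ApproxDetermined.separatedBy {ι : Type*} (t : Finset ι) {E : ι → Set X}
    (hE : ∀ i ∈ t, ApproxDetermined H (E i)) {η : ℝ≥0∞} (hη : η ≠ 0) : SeparatedBy H t E η := by
  classical
  induction t using Finset.induction_on generalizing η with
  | empty => exact ⟨∅, by simp, 1, one_pos, ∅, by simp, by simp⟩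
  | insert a t ha ih =>
    have hη2 : η / 2 ≠ 0 := by simpa using hη
    obtain ⟨s₁, hs₁, r₁, hr₁, b₁, hb₁, h₁⟩ := hE a (Finset.mem_insert_self _ _) (η / 2) hη2
    obtain ⟨s₂, hs₂, r₂, hr₂, b₂, hb₂, h₂⟩ :=
      ih (fun i hi => hE i (Finset.mem_insert_of_mem hi)) hη2
    refine ⟨s₁ ∪ s₂, fun f hf => ?_, min r₁ r₂, lt_min hr₁ hr₂, b₁ ∪ b₂, ?_, ?_⟩
    · rcases Finset.mem_union.1 hf with h | h
      · exact hs₁ f h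
      · exact hs₂ f h
    · calc μ (b₁ ∪ b₂) ≤ μ b₁ + μ b₂ := measure_union_le _ _
        _ ≤ η / 2 + η / 2 := add_le_add hb₁ hb₂
        _ = η := ENNReal.add_halves η
    · intro x hx y hy hxy i hi
      simp only [Set.mem_union, not_or] at hx hy
      rcases Finset.mem_insert.1 hi with rfl | hi
      · exact h₁ x hx.1 y hy.1 (fun f hf => (hxy f (Finset.mem_union_left _ hf)).trans_le
          (min_le_left _ _)) () (Finset.mem_singleton_self _)
      · exact h₂ x hx.2 y hy.2 (fun f hf => (hxy f (Finset.mem_union_right _ hf)).trans_le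
          (min_le_right _ _)) i hi

theorem ApproxDetermined.congr {E E' : Set X} (hE : ApproxDetermined H E) (h : E =ᵐ[μ] E') :
    ApproxDetermined H E' := by
  intro η hη
  obtain ⟨s, hs, r, hr, b, hb, h'⟩ := hE η hη
  refine ⟨s, hs, r, hr, b ∪ {x | ¬ (x ∈ E ↔ x ∈ E')}, ?_, ?_⟩
  · have h0 : μ {x | ¬ (x ∈ E ↔ x ∈ E')} = 0 := by
      have := ae_iff.1 (Filter.eventuallyEq_set.1 h)
      exact this
    calc _ ≤ μ b + μ {x | ¬ (x ∈ E ↔ x ∈ E')} := measure_union_le _ _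
      _ ≤ η := by rwa [h0, add_zero]
  · intro x hx y hy hxy i hi
    simp only [Set.mem_union, Set.mem_ofPred_eq, not_or, not_not] at hx hy
    rw [← hx.2, ← hy.2]
    exact h' x hx.1 y hy.1 hxy i hi

theorem ApproxDetermined.compl {E : Set X} (hE : ApproxDetermined H E) :
    ApproxDetermined H Eᶜ := by
  intro η hη
  obtain ⟨s, hs, r, hr, b, hb, h'⟩ := hE η hη
  exact ⟨s, hs, r, hr, b, hb, fun x hx y hy hxy i hi => not_congr (h' x hx y hy hxy i hi)⟩

/-- Continuity from above makes the part of the union missed by the first `N` sets small. It joins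
the exceptional set, and finitely many sets remain. -/
theorem ApproxDetermined.iUnion [IsFiniteMeasure μ] {E : ℕ → Set X}
    (hm : ∀ i, MeasurableSet (E i)) (hE : ∀ i, ApproxDetermined H (E i)) :
    ApproxDetermined H (⋃ i, E i) := by
  intro η hη
  have hη2 : η / 2 ≠ 0 := by simpa using hη
  let D : ℕ → Set X := fun N => (⋃ i, E i) \ ⋃ i ∈ Finset.range N, E i
  have hD : Tendsto (μ ∘ D) atTop (𝓝 (μ (⋂ N, D N))) := by
    refine tendsto_measure_iInter_atTop (fun N => ?_) (fun M N hMN x hx => ⟨hx.1, fun h => hx.2 ?_⟩)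
      ⟨0, measure_ne_top _ _⟩
    · exact ((MeasurableSet.iUnion hm).diff
        (Finset.measurableSet_biUnion _ fun i _ => hm i)).nullMeasurableSet
    · simp only [Set.mem_iUnion, Finset.mem_range] at h ⊢
      obtain ⟨i, hi, hx⟩ := h
      exact ⟨i, hi.trans_le hMN, hx⟩
  have hempty : ⋂ N, D N = ∅ := by
    ext x
    simp only [Set.mem_iInter, Set.mem_empty_iff_false, iff_false, not_forall]
    by_cases hx : ∃ i, x ∈ E i
    · obtain ⟨i, hi⟩ := hx
      refine ⟨i + 1, fun h => h.2 ?_⟩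
      simp only [Set.mem_iUnion, Finset.mem_range]
      exact ⟨i, Nat.lt_succ_self i, hi⟩
    · exact ⟨0, fun h => hx (Set.mem_iUnion.1 h.1)⟩
  rw [hempty, measure_empty] at hD
  obtain ⟨N, hN⟩ := (hD.eventually (gt_mem_nhds (pos_iff_ne_zero.2 hη2))).exists
  obtain ⟨s, hs, r, hr, b, hb, h'⟩ :=
    ApproxDetermined.separatedBy (Finset.range N) (fun i _ => hE i) hη2
  refine ⟨s, hs, r, hr, b ∪ D N, ?_, ?_⟩
  · calc μ (b ∪ D N) ≤ μ b + μ (D N) := measure_union_le _ _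
      _ ≤ η / 2 + η / 2 := add_le_add hb hN.le
      _ = η := ENNReal.add_halves η
  · intro x hx y hy hxy _ _
    simp only [Set.mem_union, not_or] at hx hy
    have key : ∀ z, z ∉ D N → (z ∈ ⋃ i, E i ↔ ∃ i ∈ Finset.range N, z ∈ E i) := by
      intro z hz
      constructor
      · intro h
        by_contra hcon
        exact hz ⟨h, by simpa using hcon⟩
      · rintro ⟨i, _, hi⟩
        exact Set.mem_iUnion.2 ⟨i, hi⟩
    rw [key x hx.2, key y hy.2]
    exact exists_congr fun i => and_congr_right fun hi => h' x hx.1 y hy.1 hxy i hi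

/-- Inner regularity of the law of `f` gives compact sets inside `A` and `Aᶜ` carrying almost all
the mass. They lie at positive distance, which serves as the tolerance `r`. -/
theorem ApproxDetermined.preimage [IsFiniteMeasure μ] {f : Lp ℂ 2 μ} (hf : f ∈ H) {A : Set ℂ}
    (hA : MeasurableSet A) : ApproxDetermined H ((f : X → ℂ) ⁻¹' A) := by
  intro η hη
  have hη2 : η / 2 ≠ 0 := by simpa using hη
  have hfm : Measurable (f : X → ℂ) := (Lp.stronglyMeasurable f).measurable
  let ν := μ.map f
  obtain ⟨K₁, hK₁A, hK₁, hμ₁⟩ := hA.exists_isCompact_sdiff_lt (μ := ν) (measure_ne_top _ _) hη2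
  obtain ⟨K₂, hK₂A, hK₂, hμ₂⟩ := hA.compl.exists_isCompact_sdiff_lt (μ := ν) (measure_ne_top _ _) hη2
  have hdisj : Disjoint K₁ K₂ :=
    Set.disjoint_left.2 fun z h₁ h₂ => hK₂A h₂ (hK₁A h₁)
  obtain ⟨r, hr, hsep⟩ := Metric.exists_pos_forall_lt_edist hK₁ hK₂.isClosed hdisj
  refine ⟨{f}, by simpa using hf, r, by exact_mod_cast hr,
    (f : X → ℂ) ⁻¹' (A \ K₁) ∪ (f : X → ℂ) ⁻¹' (Aᶜ \ K₂), ?_, ?_⟩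
  · have e₁ := Measure.map_apply (μ := μ) hfm (hA.diff hK₁.measurableSet)
    have e₂ := Measure.map_apply (μ := μ) hfm (hA.compl.diff hK₂.measurableSet)
    calc _ ≤ _ := measure_union_le _ _
      _ ≤ η / 2 + η / 2 := add_le_add (e₁ ▸ hμ₁.le) (e₂ ▸ hμ₂.le)
      _ = η := ENNReal.add_halves η
  · intro x hx y hy hxy _ _
    have hlt : edist (f x) (f y) < r := by
      rw [edist_dist, dist_eq_norm, ENNReal.ofReal_lt_coe_iff (norm_nonneg _)]
      exact hxy f (Finset.mem_singleton_self _)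
    simp only [Set.mem_union, Set.mem_preimage, Set.mem_sdiff, Set.mem_compl_iff, not_or, not_and,
      not_not] at hx hy ⊢
    constructor
    · intro h
      by_contra hc
      exact absurd (hsep _ (hx.1 h) _ (hy.2 hc)) hlt.le.not_gt
    · intro h
      by_contra hc
      rw [edist_comm] at hlt
      exact absurd (hsep _ (hy.1 h) _ (hx.2 hc)) hlt.le.not_gt

end Separation

section Generation

variable {Γ : Type*} [Group Γ] {X : Type*} [MeasurableSpace X] [MulAction Γ X]
  [MeasurableConstSMul Γ X] {μ : Measure X} [SMulInvariantMeasure Γ X μ]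

theorem coeFn_koopman (g : Γ) (f : Lp ℂ 2 μ) :
    (koopman Γ μ g f : X → ℂ) =ᵐ[μ] fun x => f (g⁻¹ • x) :=
  Lp.coeFn_compMeasurePreserving f (measurePreserving_smul g⁻¹ μ)

/-- The measurable approximately determined sets form a `σ`-algebra. It contains the generators
because `g f⁻¹(A)` agrees almost everywhere with `(ρ(g) f)⁻¹(A)` and `H` is invariant. Measurability
is carried through the induction for the sake of countable unions. -/
theorem Generates.approxDetermined [IsFiniteMeasure μ] {H : Submodule ℂ (Lp ℂ 2 μ)}
    (hH : (koopman Γ μ).IsSubrep H) (hgen : Generates Γ H) {E : Set X} (hE : MeasurableSet E) :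
    ApproxDetermined H E := by
  obtain ⟨E', hE', hEE'⟩ := hgen E hE
  refine ApproxDetermined.congr ?_ hEE'.symm
  suffices h : MeasurableSet E' ∧ ApproxDetermined H E' from h.2
  refine MeasurableSpace.generateFrom_induction
    (p := fun E _ => MeasurableSet E ∧ ApproxDetermined H E) _ ?_ ?_ ?_ ?_ E' hE'
  · rintro _ ⟨g, f, A, hf, hA, rfl⟩ _
    have himg : (fun x => g • x) '' ((f : X → ℂ) ⁻¹' A) = {x | f (g⁻¹ • x) ∈ A} := by
      ext x
      constructor
      · rintro ⟨y, hy, rfl⟩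
        simpa using hy
      · intro hx
        exact ⟨g⁻¹ • x, hx, by simp⟩
    rw [himg]
    refine ⟨((Lp.stronglyMeasurable f).measurable.comp (measurable_const_smul g⁻¹)) hA, ?_⟩
    refine (ApproxDetermined.preimage (hH.2 g f hf) hA).congr ?_
    refine Filter.eventuallyEq_set.2 ?_
    filter_upwards [coeFn_koopman g f] with x hx
    rw [Set.mem_preimage, hx]
  · exact ⟨MeasurableSet.empty, fun η _ => ⟨∅, by simp, 1, one_pos, ∅, by simp, by simp⟩⟩
  · rintro E _ ⟨h₁, h₂⟩
    exact ⟨h₁.compl, h₂.compl⟩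
  · intro E _ h
    exact ⟨MeasurableSet.iUnion fun i => (h i).1,
      ApproxDetermined.iUnion (fun i => (h i).1) fun i => (h i).2⟩

/-- A finite observable is determined, off a set of small measure, by the approximate values of
finitely many functions in a generating invariant subspace. -/
theorem Generates.exists_finset_separating [IsFiniteMeasure μ] {H : Submodule ℂ (Lp ℂ 2 μ)}
    (hH : (koopman Γ μ).IsSubrep H) (hgen : Generates Γ H) {n : ℕ} {α : X → Fin n}
    (hα : Measurable α) {η : ℝ≥0∞} (hη : η ≠ 0) :
    ∃ s : Finset (Lp ℂ 2 μ), (∀ f ∈ s, f ∈ H) ∧ ∃ r : ℝ, 0 < r ∧ ∃ bad : Set X, μ bad ≤ η ∧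
      ∀ x ∉ bad, ∀ y ∉ bad, (∀ f ∈ s, ‖f x - f y‖ < r) → α x = α y := by
  obtain ⟨s, hs, r, hr, b, hb, h⟩ := ApproxDetermined.separatedBy (H := H) Finset.univ
    (E := fun a : Fin n => α ⁻¹' {a})
    (fun a _ => hgen.approxDetermined hH (hα (measurableSet_singleton a))) hη
  refine ⟨s, hs, r, hr, b, hb, fun x hx y hy hxy => ?_⟩
  exact ((h x hx y hy hxy (α x) (Finset.mem_univ _)).1 rfl).symm

end Generation

/-! ### Uniform probabilities and shift operators on finite models -/

section Finite

theorem unifProb_eq_card {d : ℕ} (P : Fin d → Prop) [DecidablePred P] :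
    unifProb d P = ((Finset.univ.filter P).card : ℝ) / d := by
  rw [unifProb, ← Set.ncard_coe_finset]
  simp

theorem unifProb_mul_eq_card {d : ℕ} (hd : 0 < d) (P : Fin d → Prop) [DecidablePred P] :
    unifProb d P * d = ((Finset.univ.filter P).card : ℝ) := by
  rw [unifProb_eq_card, div_mul_cancel₀]
  positivity

theorem unifProb_nonneg {d : ℕ} (P : Fin d → Prop) : 0 ≤ unifProb d P := by
  unfold unifProb; positivity

theorem unifProb_not {d : ℕ} (hd : 0 < d) (P : Fin d → Prop) :
    unifProb d (fun j => ¬ P j) = 1 - unifProb d P := by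
  classical
  have h := Finset.card_filter_add_card_filter_not (s := (Finset.univ : Finset (Fin d))) P
  rw [Finset.card_univ, Fintype.card_fin] at h
  rw [unifProb_eq_card, unifProb_eq_card, eq_sub_iff_add_eq, ← add_div, div_eq_one_iff_eq]
  · rw [add_comm]; exact_mod_cast h
  · positivity

theorem unifProb_exists_le {d : ℕ} {ι : Type*} (t : Finset ι) (P : ι → Fin d → Prop) :
    unifProb d (fun j => ∃ i ∈ t, P i j) ≤ ∑ i ∈ t, unifProb d (P i) := by
  classical
  simp_rw [unifProb_eq_card]
  rw [← Finset.sum_div]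
  gcongr
  rw [← Nat.cast_sum]
  have : (Finset.univ.filter fun j => ∃ i ∈ t, P i j)
      ⊆ t.biUnion fun i => Finset.univ.filter (P i) := by
    intro j hj
    simpa using hj
  exact_mod_cast (Finset.card_le_card this).trans Finset.card_biUnion_le

/-- The operator on `ℓ²({1,…,d})` given by an element of the group ring and a map to
permutations. -/
noncomputable def shiftOp {Γ : Type*} {d : ℕ} (σ : Γ → Equiv.Perm (Fin d)) (c : Γ →₀ ℂ) :
    EuclideanSpace ℂ (Fin d) →ₗ[ℂ] EuclideanSpace ℂ (Fin d) where
  toFun v := WithLp.toLp 2 fun j => ∑ g ∈ c.support, c g * v ((σ g)⁻¹ j)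
  map_add' v w := by
    ext j
    simp [mul_add, Finset.sum_add_distrib]
  map_smul' a v := by
    ext j
    simp only [PiLp.smul_apply, smul_eq_mul, RingHom.id_apply, Finset.mul_sum]
    exact Finset.sum_congr rfl fun g _ => by ring

theorem shiftOp_apply {Γ : Type*} {d : ℕ} (σ : Γ → Equiv.Perm (Fin d)) (c : Γ →₀ ℂ)
    (v : EuclideanSpace ℂ (Fin d)) (j : Fin d) :
    shiftOp σ c v j = ∑ g ∈ c.support, c g * v ((σ g)⁻¹ j) := rfl

theorem shiftOp_single {Γ : Type*} {d : ℕ} (σ : Γ → Equiv.Perm (Fin d)) (c : Γ →₀ ℂ)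
    (l : Fin d) :
    shiftOp σ c (EuclideanSpace.single l 1)
      = ∑ g ∈ c.support, c g • EuclideanSpace.single (σ g l) (1 : ℂ) := by
  ext j
  rw [shiftOp_apply]
  simp only [WithLp.ofLp_sum, Finset.sum_apply, PiLp.smul_apply, smul_eq_mul]
  refine Finset.sum_congr rfl fun g _ => ?_
  congr 1
  by_cases h : j = σ g l
  · subst h; simp
  · have h' : (σ g).symm j ≠ l := fun e => h (by rw [← e]; simp)
    simp [h, h']

theorem norm_sq_shiftOp_single_le {Γ : Type*} {d : ℕ} (σ : Γ → Equiv.Perm (Fin d)) (c : Γ →₀ ℂ)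
    (l : Fin d) :
    ‖shiftOp σ c (EuclideanSpace.single l 1)‖ ^ 2 ≤ (∑ g ∈ c.support, ‖c g‖) ^ 2 := by
  rw [shiftOp_single]
  gcongr
  refine (norm_sum_le _ _).trans (le_of_eq (Finset.sum_congr rfl fun g _ => ?_))
  simp [norm_smul]

/-- Injectivity sends `l` to distinct points, so the terms are multiples of distinct standard basis
vectors and Pythagoras applies. -/
theorem norm_sq_shiftOp_single_of_injOn {Γ : Type*} {d : ℕ} (σ : Γ → Equiv.Perm (Fin d))
    (c : Γ →₀ ℂ) (l : Fin d) (hl : Set.InjOn (fun g => σ g l) (c.support : Set Γ)) :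
    ‖shiftOp σ c (EuclideanSpace.single l 1)‖ ^ 2 = ∑ g ∈ c.support, ‖c g‖ ^ 2 := by
  rw [shiftOp_single]
  have horth : Orthonormal ℂ (fun g : c.support => EuclideanSpace.single (σ g l) (1 : ℂ)) := by
    have h := (EuclideanSpace.basisFun (Fin d) ℂ).orthonormal.comp
      (fun g : c.support => σ g l) (fun g h e => Subtype.ext (hl g.2 h.2 e))
    simpa [Function.comp_def] using h
  have h := horth.inner_sum (fun g => c g) (fun g => c g) Finset.univ
  rw [inner_self_eq_norm_sq_to_K] at h
  have e1 : ∑ g : c.support, c g • EuclideanSpace.single (σ g l) (1 : ℂ)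
      = ∑ g ∈ c.support, c g • EuclideanSpace.single (σ g l) (1 : ℂ) :=
    Finset.sum_coe_sort c.support (fun g => c g • EuclideanSpace.single (σ g l) (1 : ℂ))
  rw [e1] at h
  have h2 : ((‖∑ g ∈ c.support, c g • EuclideanSpace.single (σ g l) (1 : ℂ)‖ ^ 2 : ℝ) : ℂ)
      = ((∑ g ∈ c.support, ‖c g‖ ^ 2 : ℝ) : ℂ) := by
    push_cast
    refine h.trans ?_
    rw [← Finset.sum_coe_sort c.support (fun g => (‖c g‖ : ℂ) ^ 2)]
    exact Finset.sum_congr rfl fun g _ => Complex.conj_mul' _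
  exact_mod_cast h2

/-- The Hilbert-Schmidt norm of `shiftOp σ c` is almost `√d * ‖c‖₂` if `σ` is almost free. -/
theorem sum_norm_sq_shiftOp_single_le {Γ : Type*} {d : ℕ} (hd : 0 < d)
    (σ : Γ → Equiv.Perm (Fin d)) (c : Γ →₀ ℂ) :
    ∑ l, ‖shiftOp σ c (EuclideanSpace.basisFun (Fin d) ℂ l)‖ ^ 2
      ≤ d * (∑ g ∈ c.support, ‖c g‖ ^ 2 + (∑ g ∈ c.support, ‖c g‖) ^ 2 *
          unifProb d (fun l => ¬ Set.InjOn (fun g => σ g l) (c.support : Set Γ))) := by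
  classical
  have h : ∀ l, ‖shiftOp σ c (EuclideanSpace.basisFun (Fin d) ℂ l)‖ ^ 2
      ≤ ∑ g ∈ c.support, ‖c g‖ ^ 2 + (∑ g ∈ c.support, ‖c g‖) ^ 2 *
        (if ¬ Set.InjOn (fun g => σ g l) (c.support : Set Γ) then 1 else 0) := by
    intro l
    rw [EuclideanSpace.basisFun_apply]
    split_ifs with hl
    · rw [norm_sq_shiftOp_single_of_injOn σ c l hl]; simp
    · refine (norm_sq_shiftOp_single_le σ c l).trans ?_
      rw [mul_one]
      exact le_add_of_nonneg_left (Finset.sum_nonneg fun _ _ => by positivity)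
  refine (Finset.sum_le_sum fun l _ => h l).trans (le_of_eq ?_)
  rw [Finset.sum_add_distrib, ← Finset.mul_sum, Finset.sum_boole, mul_add,
    ← unifProb_mul_eq_card hd]
  simp
  ring

/-- Non-injectivity is a finite union of coincidences `σ g l = σ h l` with `g ≠ h`, each
asymptotically negligible by freeness. -/
theorem SoficApproximation.eventually_injOn {Γ : Type*} [Group Γ] (Sg : SoficApproximation Γ)
    (F : Finset Γ) {κ : ℝ} (hκ : 0 < κ) :
    ∀ᶠ i in atTop, unifProb (Sg.d i)
      (fun l => ¬ Set.InjOn (fun g => Sg.σ i g l) (F : Set Γ)) ≤ κ := by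
  classical
  have hlim : Tendsto (fun i => ∑ p ∈ F.offDiag,
      (1 - unifProb (Sg.d i) fun k => Sg.σ i p.1 k ≠ Sg.σ i p.2 k)) atTop
      (𝓝 (∑ _p ∈ F.offDiag, (1 - 1))) := by
    refine tendsto_finsetSum _ fun p hp => ?_
    exact (Sg.tendsto_ne p.1 p.2 (Finset.mem_offDiag.1 hp).2.2).const_sub 1
  rw [sub_self, Finset.sum_const_zero] at hlim
  filter_upwards [hlim.eventually (gt_mem_nhds hκ)] with i hi
  refine le_trans ?_ hi.le
  have heq : (fun l => ¬ Set.InjOn (fun g => Sg.σ i g l) (F : Set Γ))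
      = fun l => ∃ p ∈ F.offDiag, ¬ (Sg.σ i p.1 l ≠ Sg.σ i p.2 l) := by
    funext l
    simp only [Set.InjOn, not_forall, Finset.mem_offDiag, not_not, eq_iff_iff, Prod.exists,
      Finset.mem_coe]
    constructor
    · rintro ⟨g, hg, h, hh, e, hne⟩; exact ⟨g, h, ⟨hg, hh, hne⟩, e⟩
    · rintro ⟨g, h, ⟨hg, hh, hne⟩, e⟩; exact ⟨g, hg, h, hh, e, hne⟩
  rw [heq]
  refine (unifProb_exists_le _ _).trans (le_of_eq (Finset.sum_congr rfl fun p _ => ?_))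
  exact unifProb_not (Sg.d_pos i) _

end Finite

/-! ### Estimates for microstates -/

section Microstates

variable {Γ : Type*} [Group Γ] {X : Type*} [MeasurableSpace X] [MulAction Γ X]
  [MeasurableConstSMul Γ X] {μ : Measure X} [IsProbabilityMeasure μ]

/-- Transfers integrals over `X` to averages along a microstate: the two distributions on `B^F`
differ by less than `δ` in `ℓ¹`, so the averages of `G` differ by at most `C * δ`. -/
theorem sum_le_of_mem_AP {m d : ℕ} {β : X → Fin m} (hβ : Measurable β) {F : Finset Γ}
    {hF : 1 ∈ F} {δ : ℝ} {σ : Γ → Equiv.Perm (Fin d)} (hd : 0 < d)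
    {φ : Fin d → (F → Fin m)} (hφ : φ ∈ AP μ β F hF δ σ) (G : (F → Fin m) → ℝ) {C : ℝ}
    (hC : 0 ≤ C) (hG : ∀ a, |G a| ≤ C) :
    ∑ j, G (φ j) ≤ d * (∫ x, G (fun g => β ((g : Γ)⁻¹ • x)) ∂μ + C * δ) := by
  classical
  let Φ : X → (F → Fin m) := fun x g => β ((g : Γ)⁻¹ • x)
  have hΦ : Measurable Φ := measurable_pi_iff.2 fun g => hβ.comp (measurable_const_smul _)
  have h_integral : ∫ x, G (Φ x) ∂μ
      = ∑ a : F → Fin m, μ.real {x | ∀ g : F, β ((g : Γ)⁻¹ • x) = a g} * G a := by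
    have : IsProbabilityMeasure (μ.map Φ) := Measure.isProbabilityMeasure_map hΦ.aemeasurable
    rw [← integral_map (f := G) hΦ.aemeasurable (measurable_of_finite G).aestronglyMeasurable,
      integral_fintype (Integrable.of_finite)]
    refine Finset.sum_congr rfl fun a _ => ?_
    rw [smul_eq_mul, map_measureReal_apply hΦ (measurableSet_singleton a)]
    congr 2
    ext x
    exact funext_iff
  have hsum : ∑ j, G (φ j) = d * ∑ a, unifProb d (fun j => φ j = a) * G a := by
    rw [Finset.mul_sum, ← Finset.sum_fiberwise Finset.univ φ]
    refine Finset.sum_congr rfl fun a _ => ?_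
    rw [← mul_assoc, mul_comm (d : ℝ), unifProb_mul_eq_card hd, ← nsmul_eq_mul,
      ← Finset.sum_const]
    exact Finset.sum_congr rfl fun j hj => by rw [(Finset.mem_filter.1 hj).2]
  rw [hsum]
  gcongr
  change _ ≤ ∫ x, G (Φ x) ∂μ + _
  rw [h_integral, ← sub_le_iff_le_add', ← Finset.sum_sub_distrib]
  calc _ ≤ ∑ a : F → Fin m, C * |unifProb d (fun j => φ j = a) -
        μ.real {x | ∀ g : F, β ((g : Γ)⁻¹ • x) = a g}| := by
        refine Finset.sum_le_sum fun a _ => ?_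
        rw [← sub_mul, mul_comm C]
        refine (le_abs_self _).trans ?_
        rw [abs_mul]
        gcongr
        exact hG a
    _ ≤ C * δ := by
        rw [← Finset.mul_sum]
        gcongr
        exact hφ.1.le

theorem unifProb_le_of_mem_AP {m d : ℕ} {β : X → Fin m} (hβ : Measurable β) {F : Finset Γ}
    {hF : 1 ∈ F} {δ : ℝ} {σ : Γ → Equiv.Perm (Fin d)} (hd : 0 < d)
    {φ : Fin d → (F → Fin m)} (hφ : φ ∈ AP μ β F hF δ σ) (N : Set (Fin m)) :
    unifProb d (fun j => φ j ⟨1, hF⟩ ∈ N) ≤ μ.real (β ⁻¹' N) + δ := by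
  classical
  have h := sum_le_of_mem_AP hβ hd hφ (fun a => if a ⟨1, hF⟩ ∈ N then 1 else 0) zero_le_one
    (fun a => by split_ifs <;> simp)
  rw [Finset.sum_boole, ← unifProb_mul_eq_card hd, mul_comm] at h
  have h_integral : ∫ x, (if β ((1 : Γ)⁻¹ • x) ∈ N then (1 : ℝ) else 0) ∂μ = μ.real (β ⁻¹' N) := by
    rw [← integral_indicator_one (hβ (MeasurableSet.of_discrete))]
    refine integral_congr_ae (Eventually.of_forall fun x => ?_)
    simp [Set.indicator_apply]
  rw [h_integral, one_mul] at h
  exact le_of_mul_le_mul_left h (by positivity)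

theorem L2_norm_sq_eq_integral {X : Type*} [MeasurableSpace X] {μ : Measure X} (f : Lp ℂ 2 μ) : ‖f‖ ^ 2 = ∫ x, ‖f x‖ ^ 2 ∂μ := by
  have h : ((‖f‖ ^ 2 : ℝ) : ℂ) = ((∫ x, ‖f x‖ ^ 2 ∂μ : ℝ) : ℂ) := by
    push_cast
    rw [← integral_complex_ofReal]
    refine (inner_self_eq_norm_sq_to_K (𝕜 := ℂ) f).symm.trans ?_
    rw [L2.inner_def]
    refine integral_congr_ae (Eventually.of_forall fun x => ?_)
    simp only [inner_self_eq_norm_sq_to_K]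
    push_cast
    rfl
  exact_mod_cast h

/-- The vector of values of `θ` along the microstate `φ`. -/
noncomputable def microVec {m d : ℕ} {F : Finset Γ} (hF : 1 ∈ F) (θ : Fin m → ℂ)
    (φ : Fin d → (F → Fin m)) : EuclideanSpace ℂ (Fin d) :=
  WithLp.toLp 2 fun j => θ (φ j ⟨1, hF⟩)

theorem norm_sq_microVec_le {m d : ℕ} {β : X → Fin m} (hβ : Measurable β) {F : Finset Γ}
    {hF : 1 ∈ F} {δ : ℝ} {σ : Γ → Equiv.Perm (Fin d)} (hd : 0 < d)
    {φ : Fin d → (F → Fin m)} (hφ : φ ∈ AP μ β F hF δ σ) {θ : Fin m → ℂ} {Θ : Lp ℂ 2 μ}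
    (hΘ : (Θ : X → ℂ) =ᵐ[μ] fun x => θ (β x)) {M : ℝ} (hθ : ∀ b, ‖θ b‖ ≤ M) :
    ‖microVec hF θ φ‖ ^ 2 ≤ d * (‖Θ‖ ^ 2 + M ^ 2 * δ) := by
  have h := sum_le_of_mem_AP hβ hd hφ (fun a => ‖θ (a ⟨1, hF⟩)‖ ^ 2) (sq_nonneg M)
    (fun a => by rw [abs_of_nonneg (by positivity)]; gcongr; exact hθ _)
  have h_integral : ∫ x, ‖θ (β ((1 : Γ)⁻¹ • x))‖ ^ 2 ∂μ = ‖Θ‖ ^ 2 := by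
    rw [L2_norm_sq_eq_integral]
    refine integral_congr_ae ?_
    filter_upwards [hΘ] with x hx
    simp [hx]
  rw [EuclideanSpace.norm_sq_eq]
  rw [h_integral] at h
  exact h

variable [SMulInvariantMeasure Γ X μ]

/-- The vector of a microstate is almost fixed by `shiftOp σ c` if the corresponding function is
almost fixed by `c`. -/
theorem norm_sq_shiftOp_microVec_sub_le {m d : ℕ} {β : X → Fin m} (hβ : Measurable β)
    {F : Finset Γ} {hF : 1 ∈ F} {δ : ℝ} {σ : Γ → Equiv.Perm (Fin d)} (hd : 0 < d)
    {φ : Fin d → (F → Fin m)} (hφ : φ ∈ AP μ β F hF δ σ) {θ : Fin m → ℂ} {Θ : Lp ℂ 2 μ}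
    (hΘ : (Θ : X → ℂ) =ᵐ[μ] fun x => θ (β x)) {M : ℝ} (hM : 0 ≤ M) (hθ : ∀ b, ‖θ b‖ ≤ M)
    {c : Γ →₀ ℂ} (hc : c.support ⊆ F) :
    ‖shiftOp σ c (microVec hF θ φ) - microVec hF θ φ‖ ^ 2
      ≤ d * (‖∑ g ∈ c.support, c g • koopman Γ μ g Θ - Θ‖ ^ 2
        + ((∑ g ∈ c.support, ‖c g‖ + 1) * M) ^ 2 * ((1 + F.card) * δ)) := by
  classical
  set C : ℝ := (∑ g ∈ c.support, ‖c g‖ + 1) * M with hC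
  have hC0 : 0 ≤ C := by positivity
  have hbound : ∀ (u : Γ → Fin m) (b : Fin m),
      ‖∑ g ∈ c.support, c g * θ (u g) - θ b‖ ≤ C := by
    intro u b
    calc _ ≤ ‖∑ g ∈ c.support, c g * θ (u g)‖ + ‖θ b‖ := norm_sub_le _ _
      _ ≤ ∑ g ∈ c.support, ‖c g‖ * M + M := by
          refine add_le_add ((norm_sum_le _ _).trans (Finset.sum_le_sum fun g _ => ?_)) (hθ b)
          rw [norm_mul]
          gcongr
          exact hθ _
      _ = C := by rw [hC, ← Finset.sum_mul]; ring
  -- The value outside `F` is arbitrary, since only `g ∈ c.support ⊆ F` enters the sum.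
  let ext' : (F → Fin m) → Γ → Fin m := fun a g => if hg : g ∈ F then a ⟨g, hg⟩ else a ⟨1, hF⟩
  let G : (F → Fin m) → ℝ := fun a =>
    ‖∑ g ∈ c.support, c g * θ (ext' a g) - θ (a ⟨1, hF⟩)‖ ^ 2
  have hG : ∀ a, |G a| ≤ C ^ 2 := fun a => by
    rw [abs_of_nonneg (by positivity)]
    exact pow_le_pow_left₀ (norm_nonneg _) (hbound _ _) 2
  have hsum := sum_le_of_mem_AP hβ hd hφ G (sq_nonneg C) hG
  have h_integral : ∫ x, G (fun g => β ((g : Γ)⁻¹ • x)) ∂μ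
      = ‖∑ g ∈ c.support, c g • koopman Γ μ g Θ - Θ‖ ^ 2 := by
    rw [L2_norm_sq_eq_integral]
    refine integral_congr_ae ?_
    have hk : ∀ᵐ x ∂μ, ∀ g ∈ c.support,
        (c g • koopman Γ μ g Θ : Lp ℂ 2 μ) x = c g * θ (β (g⁻¹ • x)) := by
      rw [Finset.eventually_all]
      intro g _
      filter_upwards [Lp.coeFn_smul (c g) (koopman Γ μ g Θ), coeFn_koopman g Θ,
        (measurePreserving_smul g⁻¹ μ).quasiMeasurePreserving.ae_eq_comp hΘ] with x h1 h2 h3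
      rw [h1, Pi.smul_apply, h2, smul_eq_mul]
      exact congrArg (c g * ·) h3
    filter_upwards [Lp.coeFn_sub (∑ g ∈ c.support, c g • koopman Γ μ g Θ) Θ,
      Lp.coeFn_finsetSum c.support (fun g => c g • koopman Γ μ g Θ), hk, hΘ] with x h1 h2 h3 h4
    rw [h1, Pi.sub_apply, h2, h4, Finset.sum_apply, Finset.sum_congr rfl h3]
    simp only [G, inv_one, one_smul]
    congr 3
    refine Finset.sum_congr rfl fun g hg => ?_
    simp only [ext', dif_pos (hc hg)]
  rw [h_integral] at hsum
  -- Off `bad` the squared coordinate equals `G (φ j)`, and on `bad` it is at most `C ^ 2`. In the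
  -- factor `1 + F.card`, the `1` pays for the error in distribution and `F.card` for the failures
  -- of equivariance.
  let bad : Fin d → Prop := fun j => ∃ g ∈ F.attach, φ j g ≠ φ ((σ g)⁻¹ j) ⟨1, hF⟩
  have hbad : unifProb d bad ≤ F.card * δ := by
    refine (unifProb_exists_le _ _).trans ?_
    rw [← Finset.card_attach, ← nsmul_eq_mul]
    exact Finset.sum_le_card_nsmul _ _ _ fun g _ => (hφ.2 g).le
  have hpt : ∀ j, ‖(shiftOp σ c (microVec hF θ φ) - microVec hF θ φ) j‖ ^ 2
      ≤ G (φ j) + C ^ 2 * (if bad j then 1 else 0) := by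
    intro j
    change ‖∑ g ∈ c.support, c g * θ (φ ((σ g)⁻¹ j) ⟨1, hF⟩) - θ (φ j ⟨1, hF⟩)‖ ^ 2 ≤ _
    split_ifs with hj
    · rw [mul_one]
      exact (pow_le_pow_left₀ (norm_nonneg _)
        (hbound (fun g => φ ((σ g)⁻¹ j) ⟨1, hF⟩) _) 2).trans
        (le_add_of_nonneg_left (by positivity))
    · rw [mul_zero, add_zero]
      refine le_of_eq ?_
      simp only [G]
      congr 3
      refine Finset.sum_congr rfl fun g hg => ?_
      have : φ j ⟨g, hc hg⟩ = φ ((σ g)⁻¹ j) ⟨1, hF⟩ := by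
        by_contra hne
        exact hj ⟨⟨g, hc hg⟩, Finset.mem_attach _ _, hne⟩
      simp only [ext', dif_pos (hc hg), this]
  rw [EuclideanSpace.norm_sq_eq]
  refine (Finset.sum_le_sum fun j _ => hpt j).trans ?_
  rw [Finset.sum_add_distrib, ← Finset.mul_sum, Finset.sum_boole, ← unifProb_mul_eq_card hd]
  have h2 : C ^ 2 * (unifProb d bad * d) ≤ C ^ 2 * (F.card * δ * d) := by gcongr
  linarith

end Microstates

/-! ### Discretization -/

/-- Chebyshev's inequality in `L²`. -/
theorem Lp.measure_le_norm_le {X : Type*} [MeasurableSpace X] {μ : Measure X} (f : Lp ℂ 2 μ)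
    {a τ : ℝ} (ha : 0 < a) (hτ : 0 ≤ τ) (h : ‖f‖ ≤ a * τ) :
    μ {x | a ≤ ‖f x‖} ≤ ENNReal.ofReal (τ ^ 2) := by
  have h1 := Lp.meas_ge_le_mul_pow_enorm f two_ne_zero ENNReal.ofNat_ne_top
    (ε := ENNReal.ofReal a) (by simpa using ha)
  have hset : {x | a ≤ ‖f x‖} = {x | ENNReal.ofReal a ≤ ‖f x‖₊} := by
    ext x
    simp only [Set.mem_ofPred_eq]
    rw [← enorm_eq_nnnorm, ← ofReal_norm, ENNReal.ofReal_le_ofReal_iff (norm_nonneg _)]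
  rw [hset]
  refine h1.trans ?_
  rw [ENNReal.toReal_ofNat, ENNReal.rpow_ofNat, ENNReal.rpow_ofNat, ← mul_pow,
    ENNReal.ofReal_pow hτ]
  gcongr
  rw [← ENNReal.ofReal_inv_of_pos ha, ← ENNReal.ofReal_mul (by positivity)]
  apply ENNReal.ofReal_le_ofReal
  rw [inv_mul_le_iff₀ ha]
  exact h

/-- A finite observable determined by finitely many `L²` functions off a small set has a finite
refinement which carries approximations of these functions and still determines it. -/
theorem exists_observable_of_separating {X : Type*} [MeasurableSpace X] {μ : Measure X}
    [IsProbabilityMeasure μ] {n : ℕ} {α : X → Fin n} (hα : Measurable α)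
    (s : Finset (Lp ℂ 2 μ)) {r : ℝ} (hr : 0 < r) {bad : Set X} {η : ℝ} (hη : 0 < η)
    (hbad : μ bad ≤ ENNReal.ofReal η)
    (hsep : ∀ x ∉ bad, ∀ y ∉ bad, (∀ f ∈ s, ‖f x - f y‖ < r) → α x = α y)
    {ε : ℝ} (hε : 0 < ε) :
    ∃ (m : ℕ) (β : X → Fin m) (π : Fin m → Fin n) (θ : s → Fin m → ℂ) (Θ : s → Lp ℂ 2 μ)
      (N : Set (Fin m)), Measurable β ∧ (∀ x, π (β x) = α x) ∧
      (∀ k, (Θ k : X → ℂ) =ᵐ[μ] fun x => θ k (β x)) ∧ (∀ k, ‖Θ k - k‖ ≤ ε) ∧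
      μ.real (β ⁻¹' N) ≤ 2 * η ∧
      ∀ b ∉ N, ∀ b' ∉ N, (∀ k, ‖θ k b - θ k b'‖ < r / 3) → π b = π b' := by
  classical
  have hX : Nonempty X := nonempty_of_isProbabilityMeasure μ
  -- As `τ ≤ 1`, also `τ ^ 2 ≤ η / (s.card + 1)`, so the Chebyshev exceptions of all functions in
  -- `s` together cost at most `η`.
  set τ : ℝ := min 1 (η / (s.card + 1)) with hτ
  have hτ0 : 0 < τ := by positivity
  have hr3 : 0 < r / 3 := by positivity
  set ε' := min ε (r / 3 * τ) with hε'
  have hε'0 : 0 < ε' := by positivity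
  have hex : ∀ k : s, ∃ q : SimpleFunc X ℂ, ∃ hq : MemLp q 2 μ, ‖hq.toLp q - (k : Lp ℂ 2 μ)‖ ≤ ε' := by
    intro k
    obtain ⟨q, hq, hmem⟩ := (Lp.memLp (k : Lp ℂ 2 μ)).exists_simpleFunc_eLpNorm_sub_lt
      ENNReal.ofNat_ne_top (ε := ENNReal.ofReal ε') (by simpa using hε'0)
    refine ⟨q, hmem, ?_⟩
    rw [norm_sub_rev, ← Lp.toLp_coeFn (k : Lp ℂ 2 μ) (Lp.memLp _), ← MemLp.toLp_sub,
      Lp.norm_toLp]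
    exact ENNReal.toReal_le_of_le_ofReal hε'0.le hq.le
  choose q hq hqn using hex
  -- The refined observable records `α` together with the values of the approximating simple
  -- functions.
  let Z := Fin n × ∀ k : s, (q k).range
  let ζ : X → Z := fun x => (α x, fun k => ⟨q k x, (q k).mem_range_self x⟩)
  have hζ : Measurable ζ := hα.prodMk
    (measurable_pi_iff.2 fun k => (q k).measurable.subtype_mk)
  let e := Fintype.equivFin Z
  let bad' : Set X := bad
    ∪ (⋃ k : s, {x | r / 3 ≤ ‖((hq k).toLp (q k) - (k : Lp ℂ 2 μ) : Lp ℂ 2 μ) x‖})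
    ∪ ⋃ k : s, {x | ¬ ((hq k).toLp (q k) - (k : Lp ℂ 2 μ) : Lp ℂ 2 μ) x = q k x - (k : Lp ℂ 2 μ) x}
  -- A label is discarded if all its points are bad, vacuously so if it is never attained. Thus the
  -- preimage of `N` lies in `bad'`, and each remaining label has a good representative to which
  -- `hsep` applies.
  let N : Set (Fin (Fintype.card Z)) := {b | ∀ x, e (ζ x) = b → x ∈ bad'}
  have hbad' : μ bad' ≤ ENNReal.ofReal (2 * η) := by
    have h0 : ∀ k : s, μ {x | ¬ ((hq k).toLp (q k) - (k : Lp ℂ 2 μ) : Lp ℂ 2 μ) x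
        = q k x - (k : Lp ℂ 2 μ) x} = 0 := by
      intro k
      rw [← ae_iff]
      filter_upwards [Lp.coeFn_sub ((hq k).toLp (q k)) (k : Lp ℂ 2 μ), (hq k).coeFn_toLp]
        with x h1 h2
      rw [h1, Pi.sub_apply, h2]
    have h1 : ∀ k : s, μ {x | r / 3 ≤ ‖((hq k).toLp (q k) - (k : Lp ℂ 2 μ) : Lp ℂ 2 μ) x‖}
        ≤ ENNReal.ofReal (η / (s.card + 1)) := by
      intro k
      refine (Lp.measure_le_norm_le _ hr3 hτ0.le ((hqn k).trans (min_le_right _ _))).trans ?_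
      apply ENNReal.ofReal_le_ofReal
      have hτ1 : τ ≤ 1 := min_le_left _ _
      have hτ2 : τ ≤ η / (s.card + 1) := min_le_right _ _
      nlinarith
    calc μ bad' ≤ μ bad + ∑ _k : s, ENNReal.ofReal (η / (s.card + 1)) + 0 := by
          refine (measure_union_le _ _).trans (add_le_add ((measure_union_le _ _).trans
            (add_le_add le_rfl ?_)) ?_)
          · exact (measure_iUnion_fintype_le _ _).trans (Finset.sum_le_sum fun k _ => h1 k)
          · exact (measure_iUnion_null h0).le
      _ ≤ ENNReal.ofReal η + ENNReal.ofReal η := by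
          rw [add_zero]
          refine add_le_add hbad ?_
          rw [← ENNReal.ofReal_sum_of_nonneg (fun _ _ => by positivity)]
          apply ENNReal.ofReal_le_ofReal
          simp only [Finset.univ_eq_attach, Finset.sum_const, Finset.card_attach, nsmul_eq_mul]
          rw [mul_div_assoc', div_le_iff₀ (by positivity)]
          nlinarith
      _ = _ := by rw [← ENNReal.ofReal_add hη.le hη.le, two_mul]
  refine ⟨Fintype.card Z, fun x => e (ζ x), fun b => (e.symm b).1, fun k b => (e.symm b).2 k,
    fun k => (hq k).toLp (q k), N, (measurable_of_finite e).comp hζ, fun x => by simp [ζ],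
    fun k => ?_, fun k => (hqn k).trans (min_le_left _ _), ?_, ?_⟩
  · filter_upwards [(hq k).coeFn_toLp] with x hx
    simp [hx, ζ]
  · refine ENNReal.toReal_le_of_le_ofReal (by positivity) ((measure_mono ?_).trans hbad')
    intro x hx
    exact hx x rfl
  · intro b hb b' hb' hbb'
    have hN : ∀ b, b ∉ N → ∃ x, e (ζ x) = b ∧ x ∉ bad' := fun b hb => by
      simpa [N] using hb
    obtain ⟨x, rfl, hx⟩ := hN b hb
    obtain ⟨y, rfl, hy⟩ := hN b' hb'
    simp only [Equiv.symm_apply_apply, ζ] at hbb' ⊢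
    have hnear : ∀ z ∉ bad', ∀ k : s, ‖q k z - (k : Lp ℂ 2 μ) z‖ < r / 3 := by
      intro z hz k
      simp only [bad', Set.mem_union, Set.mem_iUnion, Set.mem_ofPred_eq, not_or, not_exists,
        not_le, not_not] at hz
      rw [← hz.2 k]
      exact hz.1.2 k
    refine hsep x (fun h => hx (Or.inl (Or.inl h))) y (fun h => hy (Or.inl (Or.inl h)))
      fun f hf => ?_
    have h1 := hnear x hx ⟨f, hf⟩
    have h2 := hnear y hy ⟨f, hf⟩
    have h3 := hbb' ⟨f, hf⟩
    rw [norm_sub_rev] at h1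
    calc ‖f x - f y‖ = ‖(f x - q ⟨f, hf⟩ x) + (q ⟨f, hf⟩ x - q ⟨f, hf⟩ y)
          + (q ⟨f, hf⟩ y - f y)‖ := by congr 1; ring
      _ ≤ ‖f x - q ⟨f, hf⟩ x‖ + ‖q ⟨f, hf⟩ x - q ⟨f, hf⟩ y‖ + ‖q ⟨f, hf⟩ y - f y‖ :=
          norm_add₃_le
      _ < r := by linarith

/-! ### Counting microstates -/

/-- If each element `y` of a set `S` of colorings comes with vectors near a subspace `W` which
determine `y` up to small Hamming distance, then `S` is bounded by a power in `dim W` times the size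
of a Hamming ball. -/
theorem card_le_of_near_submodule {d n : ℕ} {ι E : Type*} [Fintype ι] [NormedAddCommGroup E]
    [InnerProductSpace ℂ E] [FiniteDimensional ℂ E] (S : Finset (Fin d → Fin n))
    (W : Submodule ℂ E) (v : (Fin d → Fin n) → ι → E) {R a γ N : ℝ} (hR : 0 ≤ R) (ha : 0 < a)
    (hN0 : 0 ≤ N) (hγ : 0 ≤ γ)
    (hN : ∀ y : Fin d → Fin n,
      ((Finset.univ.filter fun z => (hammingDist y z : ℝ) ≤ γ * d).card : ℝ) ≤ N)
    (hv : ∀ y ∈ S, ∀ k, ‖v y k‖ ≤ R) (hW : ∀ y ∈ S, ∀ k, ∃ w ∈ W, ‖v y k - w‖ ≤ a / 4)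
    (hclose : ∀ y ∈ S, ∀ z ∈ S, (∀ k, ‖v y k - v z k‖ < a) → (hammingDist y z : ℝ) ≤ γ * d) :
    (S.card : ℝ) ≤ (2 + 4 * R / a) ^ (Fintype.card ι * (2 * Module.finrank ℂ W)) * N := by
  classical
  have hW' : ∀ y k, ∃ w : W, y ∈ S → ‖v y k - w‖ ≤ a / 4 := by
    intro y k
    by_cases hy : y ∈ S
    · obtain ⟨w, hw, h⟩ := hW y hy k
      exact ⟨⟨w, hw⟩, fun _ => h⟩
    · exact ⟨0, fun h => absurd h hy⟩
  choose w hw using hW'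
  refine Finset.card_le_mul_of_separated S (fun y z => (hammingDist y z : ℝ) ≤ γ * d)
    (fun y => by simp; positivity) (fun y z h => by rwa [hammingDist_comm]) hN0
    (fun y _ => le_trans ?_ (hN y)) fun T hTS hT => ?_
  · exact_mod_cast Finset.card_le_card (Finset.filter_subset_filter _ (Finset.subset_univ _))
  · have hfr : Module.finrank ℝ (ι → W) = Fintype.card ι * (2 * Module.finrank ℂ W) := by
      rw [Module.finrank_pi_fintype, Finset.sum_const, finrank_real_of_complex, smul_eq_mul,
        Finset.card_univ]
    -- Moving each vector by at most `a / 4` into `W` leaves separation `a / 2` in a ball of radius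
    -- `R + a / 4`, and `1 + 2 (R + a / 4) / (a / 2) = 2 + 4 R / a`.
    have hcard := card_le_pow_finrank_of_separated (E := ι → W) T w (R := R + a / 4) (r := a / 2)
      (by positivity) (by positivity) (fun y hy => ?_) (fun y hy z hz hyz => ?_)
    · rw [hfr] at hcard
      refine hcard.trans (le_of_eq ?_)
      congr 1
      field_simp
      ring
    · refine (pi_norm_le_iff_of_nonneg (by positivity)).2 fun k => ?_
      have h1 := hw y k (hTS hy)
      have h2 := hv y (hTS hy) k
      calc ‖w y k‖ = ‖((w y k : W) : E)‖ := rfl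
        _ = ‖v y k - (v y k - w y k)‖ := by rw [sub_sub_cancel]
        _ ≤ ‖v y k‖ + ‖v y k - w y k‖ := norm_sub_le _ _
        _ ≤ R + a / 4 := add_le_add h2 h1
    · have hfar : ∃ k, a ≤ ‖v y k - v z k‖ := by
        by_contra! hcon
        exact hT y hy z hz hyz (hclose y (hTS hy) z (hTS hz) hcon)
      obtain ⟨k, hk⟩ := hfar
      refine le_trans ?_ (norm_le_pi_norm _ k)
      have h1 := hw y k (hTS hy)
      have h2 := hw z k (hTS hz)
      have h3 : ‖v y k - v z k‖ ≤ ‖v y k - w y k‖ + ‖((w y - w z) k : W)‖ + ‖v z k - w z k‖ := by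
        rw [norm_sub_rev (v z k)]
        calc ‖v y k - v z k‖ = ‖(v y k - w y k) + ((w y k : E) - w z k) + (w z k - v z k)‖ := by
              congr 1; abel
          _ ≤ _ := norm_add₃_le
      linarith

/-- Where the colors differ, one of the labels lies in `N` or some `θ k` differs by at least `r`.
Chebyshev bounds the second kind by `a ^ 2 / r ^ 2 * d` for each `k`. -/
theorem hammingDist_le_of_separating {d m n : ℕ} (hd : 0 < d) {ι : Type*} [Fintype ι]
    {π : Fin m → Fin n} {θ : ι → Fin m → ℂ} {N : Set (Fin m)} {r : ℝ} (hr : 0 < r)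
    (hsep : ∀ b ∉ N, ∀ b' ∉ N, (∀ k, ‖θ k b - θ k b'‖ < r) → π b = π b')
    (u u' : Fin d → Fin m) {p a : ℝ} (hp : unifProb d (fun j => u j ∈ N) ≤ p)
    (hp' : unifProb d (fun j => u' j ∈ N) ≤ p)
    (ha : ∀ k, ∑ j, ‖θ k (u j) - θ k (u' j)‖ ^ 2 ≤ d * a ^ 2) :
    (hammingDist (fun j => π (u j)) (fun j => π (u' j)) : ℝ)
      ≤ (2 * p + Fintype.card ι * (a ^ 2 / r ^ 2)) * d := by
  classical
  have hk : ∀ k, ((Finset.univ.filter fun j => r ≤ ‖θ k (u j) - θ k (u' j)‖).card : ℝ)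
      ≤ a ^ 2 / r ^ 2 * d := by
    intro k
    rw [div_mul_eq_mul_div, le_div_iff₀ (by positivity), mul_comm (a ^ 2)]
    refine le_trans ?_ (ha k)
    rw [← nsmul_eq_mul]
    refine (Finset.card_nsmul_le_sum _ _ _ fun j hj => ?_).trans
      (Finset.sum_le_univ_sum_of_nonneg fun _ => by positivity)
    have := (Finset.mem_filter.1 hj).2
    gcongr
  have hsub : (Finset.univ.filter fun j => π (u j) ≠ π (u' j))
      ⊆ (Finset.univ.filter fun j => u j ∈ N) ∪ (Finset.univ.filter fun j => u' j ∈ N)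
        ∪ Finset.univ.biUnion fun k => Finset.univ.filter fun j => r ≤ ‖θ k (u j) - θ k (u' j)‖ := by
    intro j hj
    have hj := (Finset.mem_filter.1 hj).2
    simp only [Finset.mem_union, Finset.mem_filter, Finset.mem_univ, true_and,
      Finset.mem_biUnion]
    by_contra! hcon
    exact hj (hsep _ hcon.1.1 _ hcon.1.2 hcon.2)
  have hcard := (Finset.card_le_card hsub).trans ((Finset.card_union_le _ _).trans
    (add_le_add (Finset.card_union_le _ _) Finset.card_biUnion_le))
  have h1 := unifProb_mul_eq_card hd (fun j => u j ∈ N)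
  have h2 := unifProb_mul_eq_card hd (fun j => u' j ∈ N)
  calc (hammingDist (fun j => π (u j)) (fun j => π (u' j)) : ℝ)
      ≤ (((Finset.univ.filter fun j => u j ∈ N).card : ℝ)
        + (Finset.univ.filter fun j => u' j ∈ N).card)
        + ∑ k, ((Finset.univ.filter fun j => r ≤ ‖θ k (u j) - θ k (u' j)‖).card : ℝ) := by
        exact_mod_cast hcard
    _ ≤ (p * d + p * d) + ∑ _k : ι, a ^ 2 / r ^ 2 * d := by
        rw [← h1, ← h2]
        gcongr with k
        exact hk k
    _ = _ := by
        simp only [Finset.sum_const, Finset.card_univ, nsmul_eq_mul]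
        ring

/-! ### Vanishing of the entropy -/

theorem ENNReal.log_natCast_div_le {N d : ℕ} (hd : 0 < d) {ε : ℝ}
    (h : (N : ℝ) ≤ Real.exp (ε * d)) :
    ENNReal.log (N : ℝ≥0∞) / ((d : ℝ) : EReal) ≤ (ε : EReal) := by
  have hd' : (0 : EReal) < ((d : ℝ) : EReal) := by exact_mod_cast hd
  rw [EReal.div_le_iff_le_mul hd' (EReal.coe_ne_top _), ← EReal.coe_mul]
  have h1 : (N : ℝ≥0∞) ≤ ENNReal.ofReal (Real.exp (ε * d)) := by
    rw [← ENNReal.ofReal_natCast]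
    exact ENNReal.ofReal_le_ofReal h
  refine (ENNReal.log_monotone h1).trans (le_of_eq ?_)
  rw [ENNReal.log_ofReal_of_pos (Real.exp_pos _), Real.log_exp, mul_comm]

section Main

variable {Γ : Type*} [Group Γ] {X : Type*} [MeasurableSpace X] [MulAction Γ X]
  [MeasurableConstSMul Γ X] {μ : Measure X} [SMulInvariantMeasure Γ X μ]

/-- Replacing `f` by a nearby `Θ`, the defect of being fixed by `c` changes little. -/
theorem norm_koopman_sum_sub_le (c : Γ →₀ ℂ) (f Θ : Lp ℂ 2 μ) :
    ‖∑ g ∈ c.support, c g • koopman Γ μ g Θ - Θ‖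
      ≤ ‖∑ g ∈ c.support, c g • koopman Γ μ g f - f‖
        + (∑ g ∈ c.support, ‖c g‖ + 1) * ‖Θ - f‖ := by
  have h : ∑ g ∈ c.support, c g • koopman Γ μ g Θ - Θ
      = (∑ g ∈ c.support, c g • koopman Γ μ g f - f)
        + (∑ g ∈ c.support, c g • koopman Γ μ g (Θ - f)) - (Θ - f) := by
    simp only [map_sub, smul_sub, Finset.sum_sub_distrib]
    abel
  have h2 : ‖∑ g ∈ c.support, c g • koopman Γ μ g (Θ - f)‖
      ≤ (∑ g ∈ c.support, ‖c g‖) * ‖Θ - f‖ := by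
    rw [Finset.sum_mul]
    refine (norm_sum_le _ _).trans (le_of_eq (Finset.sum_congr rfl fun g _ => ?_))
    rw [norm_smul, LinearIsometryEquiv.norm_map]
  rw [h]
  refine (norm_sub_le _ _).trans ?_
  have := norm_add_le (∑ g ∈ c.support, c g • koopman Γ μ g f - f)
    (∑ g ∈ c.support, c g • koopman Γ μ g (Θ - f))
  linarith

variable [IsProbabilityMeasure μ]

/-- The number of colorings induced by microstates at a single stage: almost fixed vectors lie near
a subspace of small dimension, and they determine the coloring up to small Hamming distance. -/
theorem exists_ncard_image_AP_le {d m n : ℕ} (hd : 0 < d) {ι : Type*} [Fintype ι]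
    (σ : Γ → Equiv.Perm (Fin d)) {β : X → Fin m} (hβ : Measurable β) (π : Fin m → Fin n)
    {θ : ι → Fin m → ℂ} {Θ : ι → Lp ℂ 2 μ} {N : Set (Fin m)} {c : Γ →₀ ℂ} {F : Finset Γ}
    (hF : 1 ∈ F) (hcF : c.support ⊆ F) {M R a r γ δ κ p B : ℝ} (hM : 0 ≤ M) (hR : 0 < R)
    (ha : 0 < a) (hr : 0 < r) (hγ : 0 ≤ γ) (hB : 0 ≤ B)
    (hball : ∀ y : Fin d → Fin n,
      ((Finset.univ.filter fun z => (hammingDist y z : ℝ) ≤ γ * d).card : ℝ) ≤ B)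
    (hΘ : ∀ k, (Θ k : X → ℂ) =ᵐ[μ] fun x => θ k (β x)) (hθM : ∀ k b, ‖θ k b‖ ≤ M)
    (hΘR : ∀ k, ‖Θ k‖ ^ 2 + M ^ 2 * δ ≤ R ^ 2)
    (hfix : ∀ k, ‖∑ g ∈ c.support, c g • koopman Γ μ g (Θ k) - Θ k‖ ^ 2
      + ((∑ g ∈ c.support, ‖c g‖ + 1) * M) ^ 2 * ((1 + F.card) * δ) ≤ (a / 8) ^ 2)
    (hN : μ.real (β ⁻¹' N) + δ ≤ p)
    (hNsep : ∀ b ∉ N, ∀ b' ∉ N, (∀ k, ‖θ k b - θ k b'‖ < r) → π b = π b')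
    (hp : 2 * p + Fintype.card ι * (a ^ 2 / r ^ 2) ≤ γ)
    (hHS : ∑ l, ‖shiftOp σ c (EuclideanSpace.basisFun (Fin d) ℂ l)‖ ^ 2 ≤ κ) :
    ∃ k : ℕ, k * (a / (8 * R)) ^ 2 ≤ κ ∧
      (((fun φ : Fin d → (F → Fin m) => fun j => π (φ j ⟨1, hF⟩)) '' AP μ β F hF δ σ).ncard : ℝ)
        ≤ (2 + 4 * R / a) ^ (Fintype.card ι * (2 * k)) * B := by
  classical
  have hd0' : (0 : ℝ) < d := by exact_mod_cast hd
  -- With this `t`, vectors of norm at most `R √d` are mapped within `a √d / 8` of `W`. The defect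
  -- of being fixed costs another `a √d / 8`, for a total of `a √d / 4`.
  obtain ⟨W, hWrank, hW⟩ := (shiftOp σ c).exists_submodule_norm_sub_le
    (EuclideanSpace.basisFun (Fin d) ℂ) (t := a / (8 * R)) (by positivity)
  refine ⟨Module.finrank ℂ W, hWrank.trans hHS, ?_⟩
  set 𝒮 := (fun φ : Fin d → (F → Fin m) => fun j => π (φ j ⟨1, hF⟩)) '' AP μ β F hF δ σ
    with h𝒮
  have hlift : ∀ y : Fin d → Fin n, ∃ φ : Fin d → (F → Fin m), y ∈ 𝒮.toFinset →
      φ ∈ AP μ β F hF δ σ ∧ (fun j => π (φ j ⟨1, hF⟩)) = y := by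
    intro y
    by_cases hy : y ∈ 𝒮.toFinset
    · obtain ⟨φ, hφ, e⟩ := Set.mem_toFinset.1 hy
      exact ⟨φ, fun _ => ⟨hφ, e⟩⟩
    · by_cases hφ : Nonempty (Fin d → (F → Fin m))
      · exact ⟨hφ.some, fun h => absurd h hy⟩
      · obtain ⟨x⟩ : Nonempty X := nonempty_of_isProbabilityMeasure μ
        exact absurd ⟨fun _ _ => β x⟩ hφ
  choose Φ hΦ using hlift
  have hsqrt : √(d : ℝ) ^ 2 = d := Real.sq_sqrt hd0'.le
  have hsq0 : 0 < √(d : ℝ) := Real.sqrt_pos.2 hd0'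
  have hvR : ∀ y ∈ 𝒮.toFinset, ∀ k, ‖microVec hF (θ k) (Φ y)‖ ≤ R * √d := by
    intro y hy k
    have h := norm_sq_microVec_le hβ hd (hΦ y hy).1 (hΘ k) (hθM k)
    refine abs_le_of_sq_le_sq' ?_ (by positivity) |>.2
    rw [mul_pow, hsqrt, mul_comm (R ^ 2)]
    refine h.trans ?_
    gcongr
    exact hΘR k
  have hvW : ∀ y ∈ 𝒮.toFinset, ∀ k, ∃ w ∈ W,
      ‖microVec hF (θ k) (Φ y) - w‖ ≤ a * √d / 4 := by
    intro y hy k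
    obtain ⟨w, hw, hdist⟩ := hW (microVec hF (θ k) (Φ y))
    refine ⟨w, hw, ?_⟩
    have h1 : ‖shiftOp σ c (microVec hF (θ k) (Φ y)) - microVec hF (θ k) (Φ y)‖
        ≤ a / 8 * √d := by
      have h := norm_sq_shiftOp_microVec_sub_le hβ hd (hΦ y hy).1 (hΘ k) hM (hθM k) hcF
      refine abs_le_of_sq_le_sq' ?_ (by positivity) |>.2
      rw [mul_pow, hsqrt, mul_comm ((a / 8) ^ 2)]
      refine h.trans ?_
      gcongr
      exact hfix k
    have h2 : a / (8 * R) * ‖microVec hF (θ k) (Φ y)‖ ≤ a / 8 * √d := by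
      calc a / (8 * R) * ‖microVec hF (θ k) (Φ y)‖ ≤ a / (8 * R) * (R * √d) := by gcongr; exact hvR y hy k
        _ = a / 8 * √d := by field_simp
    rw [norm_sub_rev] at h1
    calc ‖microVec hF (θ k) (Φ y) - w‖ ≤ _ :=
          norm_sub_le_norm_sub_add_norm_sub _ (shiftOp σ c (microVec hF (θ k) (Φ y))) _
      _ ≤ a * √d / 4 := by linarith
  have hclose : ∀ y ∈ 𝒮.toFinset, ∀ z ∈ 𝒮.toFinset,
      (∀ k, ‖microVec hF (θ k) (Φ y) - microVec hF (θ k) (Φ z)‖ < a * √d) →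
      (hammingDist y z : ℝ) ≤ γ * d := by
    intro y hy z hz hyz
    have hp : ∀ y ∈ 𝒮.toFinset, unifProb d (fun j => Φ y j ⟨1, hF⟩ ∈ N) ≤ p := fun y hy =>
      (unifProb_le_of_mem_AP hβ hd (hΦ y hy).1 N).trans hN
    have h := hammingDist_le_of_separating hd hr hNsep
      (fun j => Φ y j ⟨1, hF⟩) (fun j => Φ z j ⟨1, hF⟩) (hp y hy) (hp z hz) (a := a)
      (fun k => by
        have h1 := pow_le_pow_left₀ (norm_nonneg _) (hyz k).le 2
        rw [EuclideanSpace.norm_sq_eq, mul_pow, hsqrt, mul_comm] at h1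
        exact h1)
    rw [(hΦ y hy).2, (hΦ z hz).2] at h
    refine h.trans ?_
    gcongr
  have hcount := card_le_of_near_submodule 𝒮.toFinset W
    (fun y (k : ι) => microVec hF (θ k) (Φ y)) (R := R * √d) (a := a * √d) (γ := γ)
    (by positivity) (by positivity) hB hγ hball hvR hvW hclose
  rw [Set.ncard_eq_toFinset_card']
  rwa [show 4 * (R * √d) / (a * √d) = 4 * R / a by field_simp] at hcount

-- The order of choices is what matters: `γ` depends on `ε` and `n`; the functions `s` and tolerance
-- `r` on `γ`; then come `a`, `R` and `κ`, then `c`. Only after `c` is known are the precision `ε₁`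
-- of the discretization, then `F`, and finally `δ` fixed.
set_option maxHeartbeats 800000 in
theorem obsEntropy_le_of_singular (Sg : SoficApproximation Γ) {H : Submodule ℂ (Lp ℂ 2 μ)}
    (hH : (koopman Γ μ).IsSubrep H) (hgen : Generates Γ H)
    (hsing : ((koopman Γ μ).restrict H hH).Singular (leftRegular Γ)) {n : ℕ} {α : X → Fin n}
    (hα : Measurable α) {ε : ℝ} (hε : 0 < ε) : obsEntropy Sg μ α ≤ (ε : EReal) := by
  classical
  have : CompleteSpace H := hH.1.completeSpace_coe
  obtain ⟨γ, hγ, hball⟩ := exists_card_hammingBall_le_exp n (half_pos hε)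
  -- The set `N` obtained below has preimage of measure at most `2 η = γ / 8`, so with `δ ≤ γ / 16`
  -- the discarded labels cost at most `3 γ / 8` of the Hamming budget `γ`. The choice of `a` adds
  -- at most `γ / 4`.
  set η : ℝ := γ / 16 with hη
  have hη0 : 0 < η := by positivity
  obtain ⟨s, hsH, r, hr, bad, hbad, hsep⟩ :=
    hgen.exists_finset_separating hH hα (η := ENNReal.ofReal η) (by simpa using hη0)
  set a : ℝ := r / 3 * min 1 (γ / (4 * (s.card + 1))) with ha
  have ha0 : 0 < a := by positivity
  have hacard : s.card * (a ^ 2 / (r / 3) ^ 2) ≤ γ / 4 := by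
    set x : ℝ := min 1 (γ / (4 * (s.card + 1))) with hx
    have hx0 : 0 < x := by positivity
    have hx1 : x ≤ 1 := min_le_left _ _
    have hx2 : x ≤ γ / (4 * (s.card + 1)) := min_le_right _ _
    rw [le_div_iff₀ (by positivity)] at hx2
    have : a ^ 2 / (r / 3) ^ 2 = x ^ 2 := by rw [ha]; field_simp
    rw [this]
    have : (s.card : ℝ) * x ^ 2 ≤ (s.card + 1) * x := by
      have : x ^ 2 ≤ x := by nlinarith
      nlinarith [Nat.cast_nonneg (α := ℝ) s.card]
    linarith
  -- The slack `2` leaves room for `‖Θ k‖ ≤ ‖f‖ + 1` and for the sampling error `M ^ 2 * δ ≤ 1`.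
  set R : ℝ := 2 + ∑ f ∈ s, ‖f‖ with hR
  have hR0 : 0 < R := by positivity
  have hRf : ∀ f ∈ s, ‖f‖ + 2 ≤ R := fun f hf => by
    have := Finset.single_le_sum (f := fun f : Lp ℂ 2 μ => ‖f‖) (fun _ _ => norm_nonneg _) hf
    linarith
  set t : ℝ := a / (8 * R) with ht
  have ht0 : 0 < t := by positivity
  set Q : ℝ := 2 + 4 * R / a with hQ
  have hQ0 : 1 < Q := by
    have : 0 < 4 * R / a := by positivity
    linarith
  have hlogQ : 0 < Real.log Q := Real.log_pos hQ0
  -- The rank is at most `κ d / t ^ 2`, and this `κ` makes the volume factor `Q ^ (2 * s.card *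
  -- rank)` at most `exp (ε d / 2)`.
  set κ : ℝ := ε * t ^ 2 / (4 * (s.card + 1) * Real.log Q) with hκ
  have hκ0 : 0 < κ := by positivity
  set ε₂ : ℝ := min (a / 32) (min 1 (κ / 2)) with hε₂
  have hε₂0 : 0 < ε₂ := by positivity
  obtain ⟨c, hc, hcfix⟩ := exists_finsupp_small_of_singular hsing
    (fun f : s => (⟨f, hsH f f.2⟩ : H)) hε₂0
  have hcκ : ∑ g ∈ c.support, ‖c g‖ ^ 2 ≤ κ / 2 := by
    have h1 : ε₂ ≤ 1 := (min_le_right _ _).trans (min_le_left _ _)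
    have h2 : ε₂ ≤ κ / 2 := (min_le_right _ _).trans (min_le_right _ _)
    nlinarith
  have hcfix' : ∀ f ∈ s, ‖∑ g ∈ c.support, c g • koopman Γ μ g f - f‖ ≤ a / 32 := by
    intro f hf
    refine le_trans (le_of_eq ?_) ((hcfix ⟨f, hf⟩).trans (min_le_left _ _))
    rw [Submodule.coe_norm, Submodule.coe_sub, Submodule.coe_sum]
    rfl
  set C : ℝ := ∑ g ∈ c.support, ‖c g‖ + 1 with hC
  have hC0 : 0 < C := by positivity
  set ε₁ : ℝ := min 1 (a / (32 * C)) with hε₁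
  have hε₁0 : 0 < ε₁ := by positivity
  obtain ⟨m, β, π, θ, Θ, N, hβ, hπ, hΘ, hΘf, hN, hNsep⟩ :=
    exists_observable_of_separating hα s hr hη0 hbad hsep hε₁0
  have hΘfix : ∀ k : s, ‖∑ g ∈ c.support, c g • koopman Γ μ g (Θ k) - Θ k‖ ≤ a / 16 := by
    intro k
    have h1 := norm_koopman_sum_sub_le c (k : Lp ℂ 2 μ) (Θ k)
    have h2 : C * ‖Θ k - k‖ ≤ a / 32 := by
      have := (hΘf k).trans (min_le_right _ _)
      rw [le_div_iff₀ (by positivity)] at this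
      linarith
    have := hcfix' k k.2
    linarith
  have hΘR : ∀ k : s, ‖Θ k‖ ^ 2 + 1 ≤ R ^ 2 := by
    intro k
    have h1 : ‖Θ k‖ ≤ ‖(k : Lp ℂ 2 μ)‖ + 1 := by
      have := norm_le_norm_add_norm_sub' (Θ k) (k : Lp ℂ 2 μ)
      have := (hΘf k).trans (min_le_left _ _)
      linarith
    have h2 := hRf k k.2
    nlinarith [norm_nonneg (Θ k), norm_nonneg (k : Lp ℂ 2 μ)]
  set M : ℝ := ∑ k, ∑ b, ‖θ k b‖ with hM
  have hM0 : 0 ≤ M := by positivity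
  have hθM : ∀ k b, ‖θ k b‖ ≤ M := fun k b =>
    (Finset.single_le_sum (f := fun b => ‖θ k b‖) (fun _ _ => norm_nonneg _)
      (Finset.mem_univ b)).trans
    (Finset.single_le_sum (f := fun k => ∑ b, ‖θ k b‖)
      (fun _ _ => Finset.sum_nonneg fun _ _ => norm_nonneg _) (Finset.mem_univ k))
  let F : Finset Γ := insert 1 c.support
  have hF : 1 ∈ F := Finset.mem_insert_self _ _
  have hcF : c.support ⊆ F := Finset.subset_insert _ _
  set B : ℝ := (C * M) ^ 2 * (1 + F.card) with hB
  have hB0 : 0 ≤ B := by positivity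
  -- The three bounds control, in turn, the frequency of discarded labels, the norms of the
  -- microstate vectors, and their defect of being fixed.
  set δ : ℝ := min (γ / 16) (min (1 / (M ^ 2 + 1)) (a ^ 2 / 256 / (B + 1))) with hδ
  have hδ0 : 0 < δ := by positivity
  have hδ1 : δ ≤ γ / 16 := min_le_left _ _
  have hδ2 : M ^ 2 * δ ≤ 1 := by
    have : δ ≤ 1 / (M ^ 2 + 1) := (min_le_right _ _).trans (min_le_left _ _)
    rw [le_div_iff₀ (by positivity)] at this
    linarith
  have hδ3 : B * δ ≤ a ^ 2 / 256 := by
    have : δ ≤ a ^ 2 / 256 / (B + 1) := (min_le_right _ _).trans (min_le_right _ _)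
    rw [le_div_iff₀ (by positivity)] at this
    linarith
  refine iInf_le_of_le m (iInf_le_of_le β (iInf_le_of_le hβ (iInf_le_of_le π
    (iInf_le_of_le (Eventually.of_forall hπ) (iInf_le_of_le F (iInf_le_of_le hF
    (iInf_le_of_le δ (iInf_le_of_le hδ0 ?_))))))))
  refine limsup_le_of_le (h := ?_)
  -- Half of `κ` is spent on `‖c‖₂²`; this threshold keeps the contribution of the non-free points
  -- within the other half.
  filter_upwards [Sg.eventually_injOn c.support (κ := κ / 2 / C ^ 2) (by positivity)] with i hi
  set d := Sg.d i with hd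
  have hd0 : 0 < d := Sg.d_pos i
  have hd0' : (0 : ℝ) < d := by exact_mod_cast hd0
  refine ENNReal.log_natCast_div_le hd0 ?_
  have hHS : ∑ l, ‖shiftOp (Sg.σ i) c (EuclideanSpace.basisFun (Fin d) ℂ l)‖ ^ 2 ≤ κ * d := by
    refine (sum_norm_sq_shiftOp_single_le hd0 _ c).trans ?_
    have h1 : (∑ g ∈ c.support, ‖c g‖) ^ 2 ≤ C ^ 2 := by
      gcongr
      linarith
    have h2 : (∑ g ∈ c.support, ‖c g‖) ^ 2 * unifProb d
        (fun l => ¬ Set.InjOn (fun g => Sg.σ i g l) (c.support : Set Γ)) ≤ κ / 2 := by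
      rw [le_div_iff₀ (by positivity)] at hi
      have := mul_le_mul_of_nonneg_right h1 (unifProb_nonneg
        (fun l => ¬ Set.InjOn (fun g => Sg.σ i g l) (c.support : Set Γ)))
      linarith
    rw [mul_comm κ]
    gcongr
    linarith
  have hfix : ∀ k : s, ‖∑ g ∈ c.support, c g • koopman Γ μ g (Θ k) - Θ k‖ ^ 2
      + (C * M) ^ 2 * ((1 + F.card) * δ) ≤ (a / 8) ^ 2 := by
    intro k
    have h2 := pow_le_pow_left₀ (norm_nonneg _) (hΘfix k) 2
    have h3 : (C * M) ^ 2 * ((1 + F.card) * δ) = B * δ := by rw [hB]; ring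
    rw [h3]
    linarith [sq_nonneg a, show (a / 16) ^ 2 = a ^ 2 / 256 by ring,
      show (a / 8) ^ 2 = a ^ 2 / 64 by ring]
  have hp : 2 * (γ / 8 + γ / 16) + Fintype.card s * (a ^ 2 / (r / 3) ^ 2) ≤ γ := by
    rw [Fintype.card_coe]
    linarith
  obtain ⟨w, hwrank, hcount⟩ := exists_ncard_image_AP_le (δ := δ) hd0 (Sg.σ i) hβ π hF
    hcF hM0 hR0 ha0 (show 0 < r / 3 by positivity) hγ.le (Real.exp_pos _).le (hball d) hΘ hθM
    (fun k => by linarith [hΘR k]) hfix (by linarith) hNsep hp hHS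
  refine hcount.trans ?_
  rw [Fintype.card_coe]
  have hpow : Q ^ (s.card * (2 * w)) ≤ Real.exp (ε / 2 * d) := by
    rw [← Real.exp_log (pow_pos (one_pos.trans hQ0) _), Real.log_pow]
    apply Real.exp_le_exp.2
    push_cast
    have hrank : (w : ℝ) ≤ κ * d / t ^ 2 := by
      rwa [le_div_iff₀ (by positivity)]
    calc (s.card : ℝ) * (2 * w) * Real.log Q
        ≤ (s.card + 1) * (2 * (κ * d / t ^ 2)) * Real.log Q := by
          gcongr
          linarith
      _ = ε / 2 * d := by
          rw [hκ]
          field_simp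
          ring
  calc _ ≤ Real.exp (ε / 2 * d) * Real.exp (ε / 2 * d) := by gcongr
    _ = Real.exp (ε * d) := by rw [← Real.exp_add]; congr 1; ring

theorem soficEntropy_nonpos_of_singular (Sg : SoficApproximation Γ) {H : Submodule ℂ (Lp ℂ 2 μ)}
    (hH : (koopman Γ μ).IsSubrep H) (hgen : Generates Γ H)
    (hsing : ((koopman Γ μ).restrict H hH).Singular (leftRegular Γ)) : soficEntropy Sg μ ≤ 0 := by
  refine iSup_le fun n => iSup_le fun α => iSup_le fun hα => ?_
  refine EReal.le_of_forall_lt_iff_le.1 fun ε hε => ?_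
  exact obsEntropy_le_of_singular Sg hH hgen hsing hα (by exact_mod_cast hε)

end Main

/-! ### Removing the constants -/

/-- An infinite group has no nonzero invariant vectors in its regular representation. -/
theorem eq_zero_of_leftRegular_invariant {Γ : Type*} [Group Γ] [Infinite Γ]
    (f : lp (fun _ : Γ => ℂ) 2) (hf : ∀ g, leftRegular Γ g f = f) : f = 0 := by
  have hconst : ∀ x, f x = f 1 := by
    intro x
    have h : f (x⁻¹⁻¹ * 1) = f 1 := congrArg (fun u : lp (fun _ : Γ => ℂ) 2 => u 1) (hf x⁻¹)
    simpa using h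
  have hsum := (memℓp_gen_iff (p := 2) (by norm_num)).1 (lp.memℓp f)
  simp_rw [hconst] at hsum
  have h0 := (summable_const_iff _).1 hsum
  have : f 1 = 0 := by
    by_contra hne
    exact absurd h0 (Real.rpow_pos_of_pos (norm_pos_iff.2 hne) _).ne'
  ext x
  rw [hconst, this]; rfl

theorem koopman_const {Γ : Type*} [Group Γ] {X : Type*} [MeasurableSpace X] [MulAction Γ X]
    [MeasurableConstSMul Γ X] {μ : Measure X} [IsProbabilityMeasure μ] [SMulInvariantMeasure Γ X μ]
    (g : Γ) : koopman Γ μ g (Lp.const 2 μ (1 : ℂ)) = Lp.const 2 μ (1 : ℂ) := by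
  refine Lp.ext ((coeFn_koopman g _).trans ?_)
  refine ((measurePreserving_smul g⁻¹ μ).quasiMeasurePreserving.ae_eq_comp
    (Lp.coeFn_const (p := 2) (μ := μ) (1 : ℂ))).trans ?_
  exact (Lp.coeFn_const (p := 2) (μ := μ) (1 : ℂ)).symm

/-- Constants are fixed, so a unitary translate of `f` has the same inner product with `1` as `f`.
-/
theorem koopman_sub_mem_meanZero {Γ : Type*} [Group Γ] {X : Type*} [MeasurableSpace X]
    [MulAction Γ X] [MeasurableConstSMul Γ X] {μ : Measure X} [IsProbabilityMeasure μ]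
    [SMulInvariantMeasure Γ X μ] (g : Γ) (f : Lp ℂ 2 μ) : koopman Γ μ g f - f ∈ meanZero μ := by
  rw [meanZero, Submodule.mem_orthogonal_singleton_iff_inner_right, inner_sub_right, sub_eq_zero]
  have h := (koopman Γ μ g).inner_map_map (Lp.const 2 μ (1 : ℂ)) f
  rwa [koopman_const] at h

/-- Vectors on which the group acts trivially modulo `Z` do not affect singularity with respect to
the regular representation of an infinite group. -/
theorem UnitaryRep.singular_of_singular_inf {Γ : Type*} [Group Γ] [Infinite Γ] {E : Type*}
    [NormedAddCommGroup E] [InnerProductSpace ℂ E] {ρ : UnitaryRep Γ E} {H Z : Submodule ℂ E}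
    (hH : ρ.IsSubrep H) (hZ : ρ.IsSubrep Z) (hfix : ∀ g v, ρ g v - v ∈ Z)
    (hsing : (ρ.restrict (H ⊓ Z) (hH.inf hZ)).Singular (leftRegular Γ)) :
    (ρ.restrict H hH).Singular (leftRegular Γ) := by
  intro K hK T hT
  let j : (H ⊓ Z : Submodule ℂ E) →ₗ[ℂ] H := Submodule.inclusion inf_le_left
  have hjc : Continuous j := continuous_subtype_val.subtype_mk _
  -- `K'` is `K ∩ Z`. Restricting `T` embeds it in the regular representation, so it vanishes by
  -- hypothesis.
  let K' := K.comap j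
  have hK' : (ρ.restrict (H ⊓ Z) (hH.inf hZ)).IsSubrep K' :=
    ⟨hK.1.preimage hjc, fun g v hv => hK.2 g (j v) hv⟩
  have hbot := hsing K' hK'
    ⟨T.toLinearMap ∘ₗ j.restrict (p := K') (q := K) fun v hv => hv, fun v => T.norm_map _⟩
    fun g v => hT g (j.restrict (p := K') (q := K) (fun v hv => hv) v)
  -- Differences `ρ g v - v` lie in `K ∩ Z = 0`, so `K` consists of fixed vectors, which `T` sends
  -- to invariant vectors of `ℓ²(Γ)`.
  have hfixed : ∀ (g : Γ) (v : K), (ρ.restrict H hH).restrict K hK g v = v := by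
    intro g v
    have hmem : (⟨ρ g v - v, H.sub_mem (hH.2 g v (v : H).2) (v : H).2, hfix g v⟩ :
        (H ⊓ Z : Submodule ℂ E)) ∈ K' := K.sub_mem (hK.2 g v v.2) v.2
    rw [hbot, Submodule.mem_bot] at hmem
    exact Subtype.ext (Subtype.ext (sub_eq_zero.1 (congrArg Subtype.val hmem)))
  rw [Submodule.eq_bot_iff]
  intro v hv
  have h0 : T ⟨v, hv⟩ = 0 := eq_zero_of_leftRegular_invariant _ fun g => by
    rw [← hT, hfixed]
  have := (map_eq_zero_iff T T.injective).1 h0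
  exact congrArg Subtype.val this

theorem theorem1p1 {Γ : Type*} [Group Γ] [Countable Γ] (Sg : SoficApproximation Γ)
    {X : Type*} [MeasurableSpace X] [StandardBorelSpace X] [MulAction Γ X]
    [MeasurableConstSMul Γ X] (μ : Measure X) [IsProbabilityMeasure μ] [SMulInvariantMeasure Γ X μ]
    (H : Submodule ℂ (Lp ℂ 2 μ)) (hH : (koopman Γ μ).IsSubrep H) (hgen : Generates Γ H) :
    (((koopman Γ μ).restrict H hH).Singular (leftRegular Γ) → soficEntropy Sg μ ≤ 0) ∧
    (Infinite Γ →
      ((koopman Γ μ).restrict (H ⊓ meanZero μ) (hH.inf (isSubrep_meanZero Γ μ))).Singular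
        (leftRegular Γ) → soficEntropy Sg μ ≤ 0) :=
  ⟨soficEntropy_nonpos_of_singular Sg hH hgen, fun _ h =>
    soficEntropy_nonpos_of_singular Sg hH hgen (UnitaryRep.singular_of_singular_inf hH
      (isSubrep_meanZero Γ μ) koopman_sub_mem_meanZero h)⟩
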